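/- A \emph{weight sequence} is a non-decreasing sequence $M=\{m_j\}_{j\ge 0}$ of positive reals with $m_0=1$, such that $\frac{m_{j+1}}{m_j}\le \frac{m_{j+2}}{m_{j+1}}$ for all $j\ge 0$ and $\sup_{j\ge 1}\left(\frac{m_{j+1}}{m_j}\right)^{1/j}<\infty$. For a set $U\subset\mathbb R$ that is open or of the form $[0,\varepsilon)$ with $\varepsilon>0$, let $C^M(U)$ be the set of complex-valued $C^\infty$ functions $f$ on $U$ (with one-sided derivatives at $0$ if $U=[0,\varepsilon)$) for which there are $A,B>0$ such that $|f^{(k)}(x)|\le k!\,A\,B^k\,m_k$ for all $k\ge 0$ and all $x\in U$. Let $C^M_{1,0}$ be the ring of germs at $0$ of functions that belong to $C^M(U)$ for some open neighbourhood $U$ of $0$ in $\mathbb R$, let $C^M_{+,0}$ be the space of germs at $0$ of functions that belong to $C^M([0,\varepsilon))$ for some $\varepsilon>0$, and let $\mathcal O_1$ be the ring of germs at $0$ of complex-valued real analytic functions on $\mathbb R$. Write $C^M_{1,0}|_{\mathbb R_+}$ for the set of restrictions to $[0,\infty)$ of germs in $C^M_{1,0}$. The ring $C^M_{1,0}$ is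 called \emph{quasi-analytic} if the Taylor map $f\mapsto\sum_{k\ge 0}\frac{f^{(k)}(0)}{k!}z^k$ is injective on $C^M_{1,0}$. \textbf{Theorem.} Let $M,N$ be weight sequences such that $C^M_{1,0}$ and $C^N_{1,0}$ are quasi-analytic and $C^M_{1,0}$ properly contains $\mathcal O_1$. Then there is a weight sequence $K$ such that $C^K_{1,0}$ is quasi-analytic and properly contains $\mathcal O_1$, $C^N_{1,0}\subset C^K_{1,0}$, and $$\left(C^M_{+,0}\cap C^K_{1,0}|_{\mathbb R_+}\right)\setminus C^N_{1,0}|_{\mathbb R_+}\neq\emptyset .$$ -/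

import Mathlib

open Set Filter Topology
open scoped ContDiff Nat

/-- A Denjoy-Carleman weight sequence: an increasing sequence of positive reals with `m 0 = 1`,
logarithmically convex, and with `sup_{j ≥ 1} (m (j+1) / m j)^(1/j) < ∞`. -/
structure DCWeight where
  m : ℕ → ℝ
  pos : ∀ j, 0 < m j
  zero : m 0 = 1
  mono : Monotone m
  logConvex : ∀ j, m (j + 1) / m j ≤ m (j + 2) / m (j + 1)
  roots : ∃ C : ℝ, ∀ j : ℕ, 1 ≤ j → (m (j + 1) / m j) ^ (1 / (j : ℝ)) ≤ C

namespace DCWeight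

/-- The complex-valued functions that are smooth on `s` and satisfy
`|f^(k)(x)| ≤ k! A B^k m_k` for all `x ∈ s` and all `k`, for some `A, B > 0`. It is used when `s`
is an open subset of the line (where the derivatives are the usual ones) and when
`s = [0, ε)` (where the derivatives at the end point `0` are one-sided). -/
def functionClass (M : DCWeight) (s : Set ℝ) : Set (ℝ → ℂ) :=
  {f | ContDiffOn ℝ ∞ f s ∧ ∃ A B : ℝ, 0 < A ∧ 0 < B ∧
    ∀ k : ℕ, ∀ x ∈ s, ‖iteratedDerivWithin k f s x‖ ≤ (k ! : ℝ) * (A * B ^ k * M.m k)}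

theorem functionClass_inter_open (M : DCWeight) {s u : Set ℝ} (hu : IsOpen u) {f : ℝ → ℂ}
    (hf : f ∈ M.functionClass s) : f ∈ M.functionClass (s ∩ u) := by
  obtain ⟨h, A, B, hA, hB, hb⟩ := hf
  refine ⟨h.mono inter_subset_left, A, B, hA, hB, fun k x hx => ?_⟩
  have : iteratedDerivWithin k f (s ∩ u) x = iteratedDerivWithin k f s x := by
    simp only [iteratedDerivWithin, iteratedFDerivWithin_inter_open hu hx.2]
  rw [this]
  exact hb k x hx.1

theorem one_le (M : DCWeight) (k : ℕ) : 1 ≤ M.m k := by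
  have := M.mono (Nat.zero_le k)
  rwa [M.zero] at this

theorem mul_le (M : DCWeight) (i j : ℕ) : M.m i * M.m j ≤ M.m (i + j) := by
  have ratio : Monotone fun j => M.m (j + 1) / M.m j :=
    monotone_nat_of_le_succ fun j => M.logConvex j
  induction j with
  | zero => simp [M.zero]
  | succ j ih =>
    have h : M.m (j + 1) / M.m j ≤ M.m (i + j + 1) / M.m (i + j) :=
      ratio (Nat.le_add_left j i)
    rw [div_le_div_iff₀ (M.pos _) (M.pos _)] at h
    have h0 := M.pos (i + j)
    have h1 := M.pos j
    have h2 := M.pos (j + 1)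
    have h3 := M.pos (i + j + 1)
    have : M.m j * (M.m i * M.m (j + 1)) ≤ M.m j * M.m (i + j + 1) := by
      calc M.m j * (M.m i * M.m (j + 1)) = (M.m i * M.m j) * M.m (j + 1) := by ring
        _ ≤ M.m (i + j) * M.m (j + 1) := by gcongr
        _ ≤ M.m j * M.m (i + j + 1) := by linarith
    exact le_of_mul_le_mul_left this h1

theorem functionClass_const (M : DCWeight) (s : Set ℝ) (c : ℂ) :
    (fun _ => c) ∈ M.functionClass s := by
  refine ⟨contDiffOn_const, ‖c‖ + 1, 1, by positivity, one_pos, fun k x _ => ?_⟩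
  have h1 := M.one_le k
  have h2 : (1 : ℝ) ≤ (k ! : ℝ) := by exact_mod_cast Nat.factorial_pos k
  have h3 : ‖iteratedDerivWithin k (fun _ : ℝ => c) s x‖ ≤ ‖c‖ := by
    rw [iteratedDerivWithin_const]
    split_ifs <;> simp
  calc _ ≤ 1 * (‖c‖ * 1 ^ k * 1) := by simpa using h3
    _ ≤ _ := by gcongr; linarith

theorem functionClass_neg (M : DCWeight) {s : Set ℝ} {f : ℝ → ℂ}
    (hf : f ∈ M.functionClass s) : -f ∈ M.functionClass s := by
  obtain ⟨h, A, B, hA, hB, hb⟩ := hf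
  refine ⟨h.neg, A, B, hA, hB, fun k x hx => ?_⟩
  rw [iteratedDerivWithin_neg, norm_neg]
  exact hb k x hx

theorem functionClass_add (M : DCWeight) {s : Set ℝ} (hs : UniqueDiffOn ℝ s) {f g : ℝ → ℂ}
    (hf : f ∈ M.functionClass s) (hg : g ∈ M.functionClass s) : f + g ∈ M.functionClass s := by
  obtain ⟨h, A, B, hA, hB, hb⟩ := hf
  obtain ⟨h', A', B', hA', hB', hb'⟩ := hg
  refine ⟨h.add h', A + A', B + B', by positivity, by positivity, fun k x hx => ?_⟩
  have hk : ((k : ℕ∞) : WithTop ℕ∞) ≤ ∞ := by exact_mod_cast le_top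
  rw [iteratedDerivWithin_add hx hs ((h x hx).of_le hk) ((h' x hx).of_le hk)]
  have hm := M.pos k
  calc _ ≤ (k ! : ℝ) * (A * B ^ k * M.m k) + (k ! : ℝ) * (A' * B' ^ k * M.m k) :=
        (norm_add_le _ _).trans (add_le_add (hb k x hx) (hb' k x hx))
    _ ≤ (k ! : ℝ) * (A * (B + B') ^ k * M.m k) + (k ! : ℝ) * (A' * (B + B') ^ k * M.m k) := by
        gcongr <;> linarith
    _ = _ := by ring

theorem functionClass_mul (M : DCWeight) {s : Set ℝ} (hs : UniqueDiffOn ℝ s) {f g : ℝ → ℂ}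
    (hf : f ∈ M.functionClass s) (hg : g ∈ M.functionClass s) : f * g ∈ M.functionClass s := by
  obtain ⟨h, A, B, hA, hB, hb⟩ := hf
  obtain ⟨h', A', B', hA', hB', hb'⟩ := hg
  refine ⟨h.mul h', A * A', 2 * (B + B'), by positivity, by positivity, fun k x hx => ?_⟩
  have hk : ((k : ℕ∞) : WithTop ℕ∞) ≤ ∞ := by exact_mod_cast le_top
  have hmul := norm_iteratedFDerivWithin_mul_le h h' hs hx hk
  simp only [norm_iteratedFDerivWithin_eq_norm_iteratedDerivWithin] at hmul
  have hm := M.pos k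
  have hsum : ∀ i ∈ Finset.range (k + 1),
      (k.choose i : ℝ) * ‖iteratedDerivWithin i f s x‖ * ‖iteratedDerivWithin (k - i) g s x‖
        ≤ (k ! : ℝ) * (A * A' * (B + B') ^ k * M.m k) := by
    intro i hi
    have hik : i ≤ k := by simpa [Nat.lt_succ_iff] using hi
    have hfac : (k.choose i : ℝ) * (i ! : ℝ) * ((k - i)! : ℝ) = (k ! : ℝ) := by
      exact_mod_cast Nat.choose_mul_factorial_mul_factorial hik
    have hmm : M.m i * M.m (k - i) ≤ M.m k := by
      have := M.mul_le i (k - i)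
      rwa [Nat.add_sub_cancel' hik] at this
    have hpi := M.pos i
    have hpk := M.pos (k - i)
    have hBB : B ^ i * B' ^ (k - i) ≤ (B + B') ^ k := by
      calc B ^ i * B' ^ (k - i) ≤ (B + B') ^ i * (B + B') ^ (k - i) := by
            gcongr <;> linarith
        _ = (B + B') ^ k := by rw [← pow_add, Nat.add_sub_cancel' hik]
    calc _ ≤ (k.choose i : ℝ) * ((i ! : ℝ) * (A * B ^ i * M.m i)) *
            (((k - i)! : ℝ) * (A' * B' ^ (k - i) * M.m (k - i))) := by
          gcongr
          · exact hb i x hx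
          · exact hb' (k - i) x hx
      _ = ((k.choose i : ℝ) * (i ! : ℝ) * ((k - i)! : ℝ)) *
            (A * A' * (B ^ i * B' ^ (k - i)) * (M.m i * M.m (k - i))) := by ring
      _ ≤ _ := by rw [hfac]; gcongr
  have hk2 : ((k : ℝ) + 1) ≤ 2 ^ k := by
    exact_mod_cast (Nat.lt_two_pow_self : k < 2 ^ k)
  calc _ ≤ _ := hmul
    _ ≤ ((k : ℝ) + 1) * ((k ! : ℝ) * (A * A' * (B + B') ^ k * M.m k)) := by
        refine (Finset.sum_le_sum hsum).trans ?_
        simp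
    _ ≤ 2 ^ k * ((k ! : ℝ) * (A * A' * (B + B') ^ k * M.m k)) := by gcongr
    _ = _ := by rw [mul_pow]; ring

/-- The ring `C^M_{1,0}` of germs at `0`: the inductive limit of the classes `C^M(U)` over the
open neighbourhoods `U` of `0`. -/
def germRing (M : DCWeight) : Subring (Germ (𝓝 (0 : ℝ)) ℂ) where
  carrier := {a | ∃ U : Set ℝ, IsOpen U ∧ (0 : ℝ) ∈ U ∧
    ∃ f ∈ M.functionClass U, (f : Germ (𝓝 (0 : ℝ)) ℂ) = a}
  zero_mem' := ⟨univ, isOpen_univ, mem_univ _, _, M.functionClass_const univ 0, rfl⟩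
  one_mem' := ⟨univ, isOpen_univ, mem_univ _, _, M.functionClass_const univ 1, rfl⟩
  neg_mem' := by
    rintro _ ⟨U, hU, h0, f, hf, rfl⟩
    exact ⟨U, hU, h0, -f, M.functionClass_neg hf, rfl⟩
  add_mem' := by
    rintro _ _ ⟨U, hU, h0, f, hf, rfl⟩ ⟨V, hV, h0', g, hg, rfl⟩
    refine ⟨U ∩ V, hU.inter hV, ⟨h0, h0'⟩, f + g, ?_, rfl⟩
    refine M.functionClass_add (hU.inter hV).uniqueDiffOn (M.functionClass_inter_open hV hf) ?_
    rw [inter_comm]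
    exact M.functionClass_inter_open hU hg
  mul_mem' := by
    rintro _ _ ⟨U, hU, h0, f, hf, rfl⟩ ⟨V, hV, h0', g, hg, rfl⟩
    refine ⟨U ∩ V, hU.inter hV, ⟨h0, h0'⟩, f * g, ?_, rfl⟩
    refine M.functionClass_mul (hU.inter hV).uniqueDiffOn (M.functionClass_inter_open hV hf) ?_
    rw [inter_comm]
    exact M.functionClass_inter_open hU hg

/-- The space `C^M_{+,0}` of one-sided germs at `0` of functions in `C^M([0, ε))`, `ε > 0`. -/
def plusGerms (M : DCWeight) : Set (Germ (𝓝[≥] (0 : ℝ)) ℂ) :=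
  {a | ∃ ε : ℝ, 0 < ε ∧ ∃ f ∈ M.functionClass (Ico 0 ε), (f : Germ (𝓝[≥] (0 : ℝ)) ℂ) = a}

end DCWeight

/-- The ring `O_1` of germs at `0 ∈ ℝ` of (complex-valued) real analytic functions. -/
def analyticGermRing : Subring (Germ (𝓝 (0 : ℝ)) ℂ) where
  carrier := {a | ∃ f : ℝ → ℂ, AnalyticAt ℝ f 0 ∧ (f : Germ (𝓝 (0 : ℝ)) ℂ) = a}
  zero_mem' := ⟨fun _ => 0, analyticAt_const, rfl⟩
  one_mem' := ⟨fun _ => 1, analyticAt_const, rfl⟩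
  neg_mem' := by
    rintro _ ⟨f, hf, rfl⟩
    exact ⟨-f, hf.neg, rfl⟩
  add_mem' := by
    rintro _ _ ⟨f, hf, rfl⟩ ⟨g, hg, rfl⟩
    exact ⟨f + g, hf.add hg, rfl⟩
  mul_mem' := by
    rintro _ _ ⟨f, hf, rfl⟩ ⟨g, hg, rfl⟩
    exact ⟨f * g, hf.mul hg, rfl⟩

/-- The Taylor map `T_0`, sending the germ of `f` to `∑ f^(k)(0) / k! z^k`. -/
noncomputable def taylorMap (a : Germ (𝓝 (0 : ℝ)) ℂ) : PowerSeries ℂ :=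
  Germ.liftOn a (fun f => PowerSeries.mk fun k => iteratedDeriv k f 0 / (k ! : ℂ))
    (fun _ _ h => by
      ext k
      simp only [PowerSeries.coeff_mk, h.iteratedDeriv_eq k])

/-- `C^M_{1,0}` is quasi-analytic: the Taylor map is injective on it. -/
def DCWeight.QuasiAnalytic (M : DCWeight) : Prop :=
  InjOn taylorMap (M.germRing : Set (Germ (𝓝 (0 : ℝ)) ℂ))

/-- Restriction of germs at `0` to the half-line `[0, ∞)`. -/
def restrictPlus (a : Germ (𝓝 (0 : ℝ)) ℂ) : Germ (𝓝[≥] (0 : ℝ)) ℂ :=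
  a.compTendsto id (tendsto_id.mono_left nhdsWithin_le_nhds)

/-! The weight `K` is `N` with its successive ratios multiplied by an unbounded sequence `R`. If `R`
grows slowly enough, quasi-analyticity survives. This rests on compactness
(`QuasiAnalytic.exists_order`): a function obeying the `N`-bounds with fixed constants up to a high
order `L`, and flat to order `L`, is uniformly small, since otherwise a limit of counterexamples
would be a nonzero flat function in the class of `N`. Hence only finitely many bounds matter for
each pair of constants, and `R` may increase one unit at a time, after the orders already needed.

The required germ is a series of simple fractions `2⁻ʲ cⱼ / (x - zⱼ)` with `zⱼ = -δⱼ + i εⱼ` and `δⱼ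
= 1/(j+1)`. The distance from `zⱼ` to the line is `εⱼ`, which yields the `K`-bounds; the distance to
`[0, ∞)` is at least `δⱼ`, which yields the `M`-bounds there once `cⱼ` is tiny. Taking `εⱼ` to be
the inverse of a ratio of `K` makes the `K`-bound sharp at one order `k` (`exists_pole`). As `K`
exceeds `N` by more than any geometric factor, the `N`-bounds fail at `-δⱼ`, and these points
accumulate at `0`.

Proper inclusion of the analytic germs in the class of `M` forces the ratios of `M` to be unbounded,
and this is what makes `cⱼ` beat all powers of `1/δⱼ`. Finally, a germ in the class of `N` with the
same right half would coincide with the constructed one, because both lie in the quasi-analytic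
class of `K`. -/

/-! ### Chains of successive derivatives -/

/-- `F 0, F 1, F 2, …` is the sequence of successive derivatives on `s`. -/
def IsDerivChain (F : ℕ → ℝ → ℂ) (s : Set ℝ) : Prop :=
  ∀ k, ∀ x ∈ s, HasDerivWithinAt (F k) (F (k + 1) x) s x

namespace IsDerivChain

variable {F G : ℕ → ℝ → ℂ} {s t : Set ℝ}

theorem mono (h : IsDerivChain F s) (hts : t ⊆ s) : IsDerivChain F t :=
  fun k x hx => (h k x (hts hx)).mono hts

theorem hasDerivAt (h : IsDerivChain F s) (hs : IsOpen s) (k : ℕ) {x : ℝ} (hx : x ∈ s) :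
    HasDerivAt (F k) (F (k + 1) x) x :=
  (h k x hx).hasDerivAt (hs.mem_nhds hx)

theorem iteratedDerivWithin_eq (h : IsDerivChain F s) (hs : UniqueDiffOn ℝ s) (k : ℕ) :
    EqOn (iteratedDerivWithin k (F 0) s) (F k) s := by
  induction k with
  | zero => intro x _; simp
  | succ k ih =>
    intro x hx
    rw [iteratedDerivWithin_succ, derivWithin_congr ih (ih hx)]
    exact (h k x hx).derivWithin (hs x hx)

theorem contDiffOn (h : IsDerivChain F s) (hs : UniqueDiffOn ℝ s) :
    ContDiffOn ℝ ∞ (F 0) s := by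
  refine contDiffOn_of_differentiableOn_deriv fun m _ => ?_
  exact DifferentiableOn.congr (fun x hx => (h m x hx).differentiableWithinAt)
    (h.iteratedDerivWithin_eq hs m)

theorem eqOn (hF : IsDerivChain F s) (hG : IsDerivChain G s) (hs : UniqueDiffOn ℝ s)
    (h0 : EqOn (F 0) (G 0) s) (k : ℕ) : EqOn (F k) (G k) s := by
  induction k with
  | zero => exact h0
  | succ k ih =>
    intro x hx
    rw [← (hF k x hx).derivWithin (hs x hx), ← (hG k x hx).derivWithin (hs x hx)]
    exact derivWithin_congr ih (ih hx)

theorem iteratedDeriv_eq (h : IsDerivChain F s) (hs : IsOpen s) (k : ℕ) {x : ℝ} (hx : x ∈ s) :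
    iteratedDeriv k (F 0) x = F k x := by
  rw [← iteratedDerivWithin_of_isOpen hs hx, h.iteratedDerivWithin_eq hs.uniqueDiffOn k hx]

theorem sub (hF : IsDerivChain F s) (hG : IsDerivChain G s) :
    IsDerivChain (fun k x => F k x - G k x) s :=
  fun k x hx => (hF k x hx).sub (hG k x hx)

/-- The chain of `x ↦ c * f (a * x + b)`. -/
theorem comp_affine (hF : IsDerivChain F s) (a b : ℝ) (c : ℂ) (hst : ∀ x ∈ t, a * x + b ∈ s) :
    IsDerivChain (fun k x => c * ((a : ℂ) ^ k * F k (a * x + b))) t := by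
  intro k x hx
  have h1 : HasDerivWithinAt (fun x : ℝ => a * x + b) a t x := by
    simpa using ((hasDerivWithinAt_id x t).const_mul a).add_const b
  have h2 := (hF k _ (hst x hx)).scomp x h1 hst
  have h3 := (h2.const_mul ((a : ℂ) ^ k)).const_mul c
  refine h3.congr_deriv ?_
  simp only [Complex.real_smul]
  ring

end IsDerivChain

theorem ContDiffOn.isDerivChain {f : ℝ → ℂ} {s : Set ℝ} (hf : ContDiffOn ℝ ∞ f s)
    (hs : UniqueDiffOn ℝ s) : IsDerivChain (fun k => iteratedDerivWithin k f s) s := by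
  intro k x hx
  have h := hf.differentiableOn_iteratedDerivWithin (m := k)
    (by exact_mod_cast ENat.natCast_lt_top k) hs x hx
  simpa [iteratedDerivWithin_succ] using h.hasDerivWithinAt

/-! ### Germs as chains, and propagation of flatness -/

namespace DCWeight

theorem mem_functionClass (M : DCWeight) {F : ℕ → ℝ → ℂ} {s : Set ℝ} (hF : IsDerivChain F s)
    (hs : UniqueDiffOn ℝ s) {A B : ℝ} (hA : 0 < A) (hB : 0 < B)
    (hb : ∀ k, ∀ x ∈ s, ‖F k x‖ ≤ (k ! : ℝ) * (A * B ^ k * M.m k)) :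
    F 0 ∈ M.functionClass s := by
  refine ⟨hF.contDiffOn hs, A, B, hA, hB, fun k x hx => ?_⟩
  rw [hF.iteratedDerivWithin_eq hs k hx]
  exact hb k x hx

theorem mem_germRing (M : DCWeight) {F : ℕ → ℝ → ℂ} {s : Set ℝ} (hF : IsDerivChain F s)
    (hs : IsOpen s) (h0 : (0 : ℝ) ∈ s) {A B : ℝ} (hA : 0 < A) (hB : 0 < B)
    (hb : ∀ k, ∀ x ∈ s, ‖F k x‖ ≤ (k ! : ℝ) * (A * B ^ k * M.m k)) :
    ((F 0 : ℝ → ℂ) : Germ (𝓝 (0 : ℝ)) ℂ) ∈ M.germRing :=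
  ⟨s, hs, h0, F 0, M.mem_functionClass hF hs.uniqueDiffOn hA hB hb, rfl⟩

/-- Every germ in `C^M_{1,0}` is represented by a chain of derivatives on an interval. -/
theorem exists_isDerivChain (M : DCWeight) {a : Germ (𝓝 (0 : ℝ)) ℂ} (ha : a ∈ M.germRing) :
    ∃ (F : ℕ → ℝ → ℂ) (r A B : ℝ), 0 < r ∧ 0 < A ∧ 0 < B ∧ IsDerivChain F (Ioo (-r) r) ∧
      (∀ k, ∀ x ∈ Ioo (-r) r, ‖F k x‖ ≤ (k ! : ℝ) * (A * B ^ k * M.m k)) ∧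
      ((F 0 : ℝ → ℂ) : Germ (𝓝 (0 : ℝ)) ℂ) = a := by
  obtain ⟨U, hU, h0, f, ⟨hf, A, B, hA, hB, hb⟩, rfl⟩ := ha
  obtain ⟨r, hr, hrU⟩ := Metric.isOpen_iff.1 hU 0 h0
  rw [Real.ball_eq_Ioo, zero_sub, zero_add] at hrU
  refine ⟨fun k => iteratedDerivWithin k f U, r, A, B, hr, hA, hB,
    (hf.isDerivChain hU.uniqueDiffOn).mono hrU, fun k x hx => hb k x (hrU hx), ?_⟩
  simp

theorem taylorMap_eq_zero {F : ℕ → ℝ → ℂ} {s : Set ℝ} (hF : IsDerivChain F s)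
    (hs : IsOpen s) (h0 : (0 : ℝ) ∈ s) (hflat : ∀ k, F k 0 = 0) :
    taylorMap ((F 0 : ℝ → ℂ) : Germ (𝓝 (0 : ℝ)) ℂ) = 0 := by
  ext k
  have : iteratedDeriv k (F 0) 0 = 0 := by rw [hF.iteratedDeriv_eq hs k h0, hflat]
  change (PowerSeries.mk fun k => iteratedDeriv k (F 0) 0 / (k ! : ℂ)).coeff k = _
  simp [this]

theorem taylorMap_zero : taylorMap (0 : Germ (𝓝 (0 : ℝ)) ℂ) = 0 := by
  ext k
  change (PowerSeries.mk fun k => iteratedDeriv k (fun _ : ℝ => (0 : ℂ)) 0 / (k ! : ℂ)).coeff k = _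
  simp

/-- In a quasi-analytic class, a flat function vanishes near the point. -/
theorem QuasiAnalytic.eventually_eq_zero {N : DCWeight} (hN : N.QuasiAnalytic)
    {F : ℕ → ℝ → ℂ} {s : Set ℝ} (hF : IsDerivChain F s) (hs : IsOpen s) {A B : ℝ}
    (hA : 0 < A) (hB : 0 < B)
    (hb : ∀ k, ∀ x ∈ s, ‖F k x‖ ≤ (k ! : ℝ) * (A * B ^ k * N.m k))
    {y : ℝ} (hy : y ∈ s) (hflat : ∀ k, F k y = 0) : ∀ᶠ x in 𝓝 y, F 0 x = 0 := by
  -- The bounds are translation invariant, so the uniqueness at `0` can be moved to `y`.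
  set t : Set ℝ := (fun x => x + y) ⁻¹' s
  have ht : IsOpen t := hs.preimage (by fun_prop)
  have h0t : (0 : ℝ) ∈ t := by simpa [t] using hy
  have hG : IsDerivChain (fun k x => F k (x + y)) t := by
    have := hF.comp_affine (t := t) 1 y 1 (fun x hx => by simpa [t] using hx)
    simpa using this
  have hmem := N.mem_germRing hG ht h0t hA hB fun k x hx => hb k (x + y) hx
  have h := hN hmem N.germRing.zero_mem
    ((taylorMap_eq_zero hG ht h0t fun k => by simpa using hflat k).trans taylorMap_zero.symm)
  have h' : ∀ᶠ x in 𝓝 (0 : ℝ), F 0 (x + y) = 0 := Germ.coe_eq.1 h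
  have hc : Tendsto (fun x : ℝ => x - y) (𝓝 y) (𝓝 0) := by
    have : Continuous fun x : ℝ => x - y := by fun_prop
    simpa using this.tendsto y
  simpa using hc.eventually h'

/-- The set where all derivatives vanish is open by local uniqueness and relatively closed by
continuity, so connectedness makes it everything. -/
theorem QuasiAnalytic.eqOn_zero {N : DCWeight} (hN : N.QuasiAnalytic)
    {F : ℕ → ℝ → ℂ} {s : Set ℝ} (hF : IsDerivChain F s) (hs : IsOpen s)
    (hs' : IsPreconnected s) {A B : ℝ} (hA : 0 < A) (hB : 0 < B)
    (hb : ∀ k, ∀ x ∈ s, ‖F k x‖ ≤ (k ! : ℝ) * (A * B ^ k * N.m k))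
    {y : ℝ} (hy : y ∈ s) (hflat : ∀ k, F k y = 0) : ∀ x ∈ s, F 0 x = 0 := by
  set u : Set ℝ := {x | x ∈ s ∧ ∀ k, F k x = 0}
  have hu : IsOpen u := by
    rw [isOpen_iff_mem_nhds]
    rintro x ⟨hx, hx0⟩
    have h1 := hN.eventually_eq_zero hF hs hA hB hb hx hx0
    obtain ⟨v, hv, hvo, hxv⟩ := eventually_nhds_iff.1 (h1.and (hs.mem_nhds hx))
    refine mem_of_superset (hvo.mem_nhds hxv) fun z hz => ⟨(hv z hz).2, fun k => ?_⟩
    exact (hF.mono fun w hw => (hv w hw).2).eqOn (G := fun _ _ => 0)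
      (fun k x _ => hasDerivWithinAt_const _ _ _) hvo.uniqueDiffOn
      (fun w hw => (hv w hw).1) k hz
  have hsub : s ⊆ u := by
    refine hs'.subset_of_closure_inter_subset hu ⟨y, hy, hy, hflat⟩ ?_
    rintro x ⟨hxu, hx⟩
    refine ⟨hx, fun k => ?_⟩
    have hc : ContinuousWithinAt (F k) u x :=
      (hF.hasDerivAt hs k hx).continuousAt.continuousWithinAt
    have := hc.mem_closure_image hxu
    have h2 : F k '' u ⊆ {0} := by
      rintro _ ⟨z, hz, rfl⟩
      exact hz.2 k
    simpa using closure_mono h2 this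
  exact fun x hx => (hsub hx).2 0

end DCWeight

/-! ### Compactness of quasi-analytic bounds -/

/-- Limits along an ultrafilter handle all orders and all points at once, replacing a diagonal
extraction of subsequences. -/
theorem Ultrafilter.exists_tendsto_of_eventually_norm_le {ι : Type*} (𝒰 : Ultrafilter ι)
    {u : ι → ℂ} {C : ℝ} (h : ∀ᶠ i in 𝒰, ‖u i‖ ≤ C) : ∃ z, Tendsto u 𝒰 (𝓝 z) := by
  obtain ⟨z, -, hz⟩ := (isCompact_closedBall (0 : ℂ) C).ultrafilter_le_nhds' (𝒰.map u)
    (by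
      have : ∀ᶠ i in 𝒰, u i ∈ Metric.closedBall (0 : ℂ) C := by simpa using h
      exact this)
  exact ⟨z, hz⟩

namespace IsDerivChain

variable {F : ℕ → ℝ → ℂ} {s : Set ℝ}

theorem norm_sub_le (hF : IsDerivChain F s) (hs : Convex ℝ s) {k : ℕ} {C : ℝ}
    (hC : ∀ x ∈ s, ‖F (k + 1) x‖ ≤ C) {x y : ℝ} (hx : x ∈ s) (hy : y ∈ s) :
    ‖F k y - F k x‖ ≤ C * |y - x| :=
  hs.norm_image_sub_le_of_norm_hasDerivWithin_le (fun z hz => hF k z hz) hC hx hy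

/-- A quadratic remainder estimate whose constant depends only on the bound of order `k + 2`. It
therefore passes to pointwise limits, and shows that limits of chains are again chains. -/
theorem norm_sub_sub_le (hF : IsDerivChain F s) (hs : Convex ℝ s) {k : ℕ} {C : ℝ}
    (hC : ∀ x ∈ s, ‖F (k + 2) x‖ ≤ C) {x y : ℝ} (hx : x ∈ s) (hy : y ∈ s) :
    ‖F k y - F k x - (y - x) • F (k + 1) x‖ ≤ C * |y - x| * |y - x| := by
  have hC0 : 0 ≤ C := (norm_nonneg _).trans (hC x hx)
  have hsub : uIcc x y ⊆ s := hs.ordConnected.uIcc_subset hx hy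
  have h := (convex_uIcc x y).norm_image_sub_le_of_norm_hasDerivWithin_le
    (f := fun t => F k t - (t - x) • F (k + 1) x) (f' := fun t => F (k + 1) t - F (k + 1) x)
    (C := C * |y - x|) (x := x) (y := y)
    (fun t ht => by
      have h1 : HasDerivWithinAt (fun t : ℝ => t - x) 1 (uIcc x y) t :=
        (hasDerivWithinAt_id t _).sub_const x
      have h2 := ((hF k t (hsub ht)).mono hsub).sub (h1.smul_const (F (k + 1) x))
      exact h2.congr_deriv (by simp))
    (fun t ht => by
      exact (hF.norm_sub_le hs hC hx (hsub ht)).trans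
        (mul_le_mul_of_nonneg_left (abs_sub_left_of_mem_uIcc ht) hC0))
    left_mem_uIcc right_mem_uIcc
  have e : F k y - F k x - (y - x) • F (k + 1) x =
      (F k y - (y - x) • F (k + 1) x) - (F k x - (x - x) • F (k + 1) x) := by
    rw [sub_self, zero_smul]
    ring
  rw [e]
  exact h

end IsDerivChain

theorem hasDerivWithinAt_of_norm_sub_sub_le {f : ℝ → ℂ} {f' : ℂ} {s : Set ℝ} {x C : ℝ}
    (h : ∀ y ∈ s, ‖f y - f x - (y - x) • f'‖ ≤ C * |y - x| * |y - x|) :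
    HasDerivWithinAt f f' s x := by
  rw [hasDerivWithinAt_iff_isLittleO]
  have h1 : (fun y => f y - f x - (y - x) • f') =O[𝓝[s] x] fun y => (y - x) * (y - x) := by
    refine Asymptotics.IsBigO.of_bound C ?_
    filter_upwards [self_mem_nhdsWithin] with y hy
    simpa [mul_assoc] using h y hy
  refine h1.trans_isLittleO ?_
  have h2 : (fun y : ℝ => y - x) =o[𝓝[s] x] fun _ => (1 : ℝ) := by
    rw [Asymptotics.isLittleO_one_iff]
    have : Continuous fun y : ℝ => y - x := by fun_prop
    simpa using (this.tendsto x).mono_left nhdsWithin_le_nhds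
  simpa using h2.mul_isBigO (Asymptotics.isBigO_refl (fun y : ℝ => y - x) (𝓝[s] x))

namespace DCWeight

/-- Compactness form of quasi-analyticity: a function which is flat to sufficiently high order
and obeys sufficiently many of the bounds of a quasi-analytic class is small. -/
theorem QuasiAnalytic.exists_order {N : DCWeight} (hN : N.QuasiAnalytic) {b η : ℝ}
    (hb : 0 < b) (hη : 0 < η) :
    ∃ L : ℕ, ∀ F : ℕ → ℝ → ℂ, IsDerivChain F (Ioo (-1) 1) →
      (∀ k ≤ L, ∀ x ∈ Ioo (-1 : ℝ) 1, ‖F k x‖ ≤ (k ! : ℝ) * (b ^ k * N.m k)) →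
      (∀ k ≤ L, F k 0 = 0) → ∀ x ∈ Icc (-1 / 2 : ℝ) (1 / 2), ‖F 0 x‖ ≤ η := by
  -- For each `L` this leaves a chain `F L`, flat and bounded to order `L`, that exceeds `η` at a
  -- point `x L`.
  by_contra! hcon
  choose F hF hbd hflat x hx hxη using hcon
  set s : Set ℝ := Ioo (-1) 1
  have hs : Convex ℝ s := convex_Ioo _ _
  set 𝒰 := hyperfilter ℕ
  have hev : ∀ k : ℕ, ∀ᶠ L in (𝒰 : Filter ℕ), k ≤ L := fun k =>
    Nat.hyperfilter_le_atTop (eventually_ge_atTop k)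
  have hlim : ∀ k y, ∃ z, y ∈ s → Tendsto (fun L => F L k y) 𝒰 (𝓝 z) := by
    intro k y
    by_cases hy : y ∈ s
    · obtain ⟨z, hz⟩ := 𝒰.exists_tendsto_of_eventually_norm_le (u := fun L => F L k y)
        ((hev k).mono fun L hL => hbd L k hL y hy)
      exact ⟨z, fun _ => hz⟩
    · exact ⟨0, fun h => absurd h hy⟩
  choose G hG using hlim
  have hGb : ∀ k, ∀ y ∈ s, ‖G k y‖ ≤ (k ! : ℝ) * (1 * b ^ k * N.m k) := fun k y hy => by
    rw [one_mul]
    exact le_of_tendsto (hG k y hy).norm ((hev k).mono fun L hL => hbd L k hL y hy)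
  have hGc : IsDerivChain G s := by
    intro k y hy
    refine hasDerivWithinAt_of_norm_sub_sub_le
      (C := ((k + 2)! : ℝ) * (b ^ (k + 2) * N.m (k + 2))) fun z hz => ?_
    refine le_of_tendsto (((hG k z hz).sub (hG k y hy)).sub
      ((hG (k + 1) y hy).const_smul (z - y))).norm ?_
    exact (hev (k + 2)).mono fun L hL =>
      (hF L).norm_sub_sub_le hs (fun w hw => hbd L (k + 2) hL w hw) hy hz
  have h0 : (0 : ℝ) ∈ s := by simp [s]
  have hG0 : ∀ k, G k 0 = 0 := fun k => by
    refine tendsto_nhds_unique (hG k 0 h0) ?_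
    exact tendsto_const_nhds.congr' ((hev k).mono fun L hL => (hflat L k hL).symm)
  have hz := hN.eqOn_zero hGc isOpen_Ioo isPreconnected_Ioo one_pos hb hGb h0 hG0
  -- The points `x L` move with `L`; they converge along the ultrafilter, and the bound on the first
  -- derivative carries the lower bound `η` over to their limit.
  obtain ⟨y, hy, hy_le⟩ := (isCompact_Icc (a := (-1 / 2 : ℝ)) (b := 1 / 2)).ultrafilter_le_nhds'
    (𝒰.map x) (Eventually.of_forall hx : ∀ᶠ L in (𝒰 : Filter ℕ), x L ∈ _)
  have hIcc : Icc (-1 / 2 : ℝ) (1 / 2) ⊆ s := fun t ht => by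
    constructor <;> linarith [ht.1, ht.2]
  have hy_lim : Tendsto x 𝒰 (𝓝 y) := hy_le
  set C : ℝ := ((0 + 1)! : ℝ) * (b ^ (0 + 1) * N.m (0 + 1))
  have hle : ∀ᶠ L in (𝒰 : Filter ℕ), η ≤ ‖F L 0 y‖ + C * |x L - y| := by
    filter_upwards [hev (0 + 1)] with L hL
    have h1 := (hF L).norm_sub_le hs (fun w hw => hbd L (0 + 1) hL w hw) (hIcc hy) (hIcc (hx L))
    have h2 := norm_sub_norm_le (F L 0 (x L)) (F L 0 y)
    have h3 := hxη L
    linarith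
  have ht : Tendsto (fun L => ‖F L 0 y‖ + C * |x L - y|) 𝒰 (𝓝 (‖G 0 y‖ + C * |y - y|)) :=
    (hG 0 y (hIcc hy)).norm.add (((hy_lim.sub_const y).abs).const_mul C)
  have := ge_of_tendsto ht hle
  rw [hz y (hIcc hy)] at this
  simp at this
  linarith

end DCWeight

/-! ### Enlarging a quasi-analytic weight -/

/-- A slowly growing sequence whose partial products obey prescribed geometric bounds. -/
theorem exists_slowly_tendsto_atTop (L' : ℕ → ℕ) :
    ∃ R : ℕ → ℝ, Monotone R ∧ (∀ k, 1 ≤ R k) ∧ (∀ k, R k ≤ k + 1) ∧ Tendsto R atTop atTop ∧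
      ∀ j, ∀ k ≤ L' j, ∏ i ∈ Finset.range k, R i ≤ ((j : ℝ) + 1) ^ k := by
  -- A monotone majorant of `L'`.
  set L : ℕ → ℕ := fun j => ∑ i ∈ Finset.range (j + 1), L' i
  have hLmono : Monotone L := fun i j hij =>
    Finset.sum_le_sum_of_subset (Finset.range_subset_range.2 (by omega))
  have hLL : ∀ j, L' j ≤ L j := fun j =>
    Finset.single_le_sum (f := L') (fun _ _ => Nat.zero_le _) (Finset.self_mem_range_succ j)
  -- The count of thresholds already passed: at most `j` before `L j`, yet unbounded. Counting only
  -- indices below `k` keeps the set finite and gives `c k ≤ k`.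
  set c : ℕ → ℕ := fun k => ((Finset.range k).filter fun j => L j ≤ k).card
  have hcmono : Monotone c := fun k l hkl => by
    refine Finset.card_le_card fun j hj => ?_
    simp only [Finset.mem_filter, Finset.mem_range] at hj ⊢
    omega
  have hck : ∀ k, c k ≤ k := fun k => (Finset.card_filter_le _ _).trans (by simp)
  have hcL : ∀ j, ∀ k < L j, c k ≤ j := by
    intro j k hk
    calc c k ≤ (Finset.range j).card := by
          refine Finset.card_le_card fun i hi => ?_
          simp only [Finset.mem_filter, Finset.mem_range] at hi ⊢
          by_contra! hji
          have := hLmono hji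
          omega
      _ = j := Finset.card_range j
  have hctop : Tendsto c atTop atTop := by
    refine tendsto_atTop.2 fun C => ?_
    filter_upwards [eventually_ge_atTop (L C), eventually_ge_atTop C] with k hk1 hk2
    calc C = (Finset.range C).card := (Finset.card_range C).symm
      _ ≤ c k := by
        refine Finset.card_le_card fun i hi => ?_
        simp only [Finset.mem_filter, Finset.mem_range] at hi ⊢
        have := hLmono hi.le
        omega
  set R : ℕ → ℝ := fun k => (c k : ℝ) + 1
  have hR : Monotone R := fun k l hkl => by
    have : (c k : ℝ) ≤ c l := by exact_mod_cast hcmono hkl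
    simp only [R]
    linarith
  have h1 : ∀ k, 1 ≤ R k := fun k => by simp [R]
  have h2 : ∀ k, R k ≤ k + 1 := fun k => by
    have : (c k : ℝ) ≤ k := by exact_mod_cast hck k
    simp only [R]
    linarith
  refine ⟨R, hR, h1, h2,
    tendsto_atTop_add_const_right _ _ (tendsto_natCast_atTop_atTop.comp hctop), fun j k hk => ?_⟩
  calc ∏ i ∈ Finset.range k, R i ≤ ∏ _i ∈ Finset.range k, ((j : ℝ) + 1) := by
        refine Finset.prod_le_prod (fun i _ => zero_le_one.trans (h1 i)) fun i hi => ?_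
        have hi' : i < L j := (Finset.mem_range.1 hi).trans_le (hk.trans (hLL j))
        have : (c i : ℝ) ≤ j := by exact_mod_cast hcL j i hi'
        simp only [R]
        linarith
    _ = _ := by simp

namespace DCWeight

theorem monotone_ratio (M : DCWeight) : Monotone fun j => M.m (j + 1) / M.m j :=
  monotone_nat_of_le_succ fun j => M.logConvex j

theorem one_le_ratio (M : DCWeight) (j : ℕ) : 1 ≤ M.m (j + 1) / M.m j :=
  (one_le_div (M.pos j)).2 (M.mono j.le_succ)

/-- The weight obtained from `N` by multiplying its successive ratios by `R`. -/
noncomputable def mulRatio (N : DCWeight) (R : ℕ → ℝ) (hR : Monotone R) (h1 : ∀ k, 1 ≤ R k)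
    (h2 : ∀ k, R k ≤ k + 1) : DCWeight where
  m k := N.m k * ∏ i ∈ Finset.range k, R i
  pos k := mul_pos (N.pos k) (Finset.prod_pos fun i _ => one_pos.trans_le (h1 i))
  zero := by simp [N.zero]
  mono := by
    refine monotone_nat_of_le_succ fun k => ?_
    have hp : 0 < ∏ i ∈ Finset.range k, R i :=
      Finset.prod_pos fun i _ => one_pos.trans_le (h1 i)
    rw [Finset.prod_range_succ]
    have := N.pos (k + 1)
    exact mul_le_mul (N.mono k.le_succ) (le_mul_of_one_le_right hp.le (h1 k)) hp.le this.le
  logConvex k := by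
    have hp : ∀ k, 0 < ∏ i ∈ Finset.range k, R i := fun k =>
      Finset.prod_pos fun i _ => one_pos.trans_le (h1 i)
    have e : ∀ k, N.m (k + 1) * (∏ i ∈ Finset.range (k + 1), R i) /
        (N.m k * ∏ i ∈ Finset.range k, R i) = N.m (k + 1) / N.m k * R k := fun k => by
      rw [Finset.prod_range_succ]
      have := (hp k).ne'
      have := (N.pos k).ne'
      field_simp
    rw [e, e]
    have := one_pos.trans_le (h1 k)
    have := one_pos.trans_le (N.one_le_ratio (k + 1))
    exact mul_le_mul (N.logConvex k) (hR k.le_succ) (by positivity) this.le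
  roots := by
    obtain ⟨C, hC⟩ := N.roots
    refine ⟨C * 2, fun j hj => ?_⟩
    have hp : ∀ k, 0 < ∏ i ∈ Finset.range k, R i := fun k =>
      Finset.prod_pos fun i _ => one_pos.trans_le (h1 i)
    have e : N.m (j + 1) * (∏ i ∈ Finset.range (j + 1), R i) /
        (N.m j * ∏ i ∈ Finset.range j, R i) = N.m (j + 1) / N.m j * R j := by
      rw [Finset.prod_range_succ]
      have := (hp j).ne'
      have := (N.pos j).ne'
      field_simp
    have hR0 := one_pos.trans_le (h1 j)
    have hN0 := one_pos.trans_le (N.one_le_ratio j)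
    rw [e, Real.mul_rpow hN0.le hR0.le]
    have hj0 : (0 : ℝ) < j := by exact_mod_cast hj
    -- Here linear growth of `R` is needed: `R j ≤ j + 1 ≤ 2 ^ j`.
    have hRj : R j ^ (1 / (j : ℝ)) ≤ 2 := by
      have h3 : R j ≤ (2 : ℝ) ^ (j : ℝ) := by
        rw [Real.rpow_natCast]
        refine (h2 j).trans ?_
        exact_mod_cast (Nat.lt_two_pow_self : j < 2 ^ j)
      calc R j ^ (1 / (j : ℝ)) ≤ ((2 : ℝ) ^ (j : ℝ)) ^ (1 / (j : ℝ)) := by gcongr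
        _ = 2 := by
          rw [← Real.rpow_mul (by norm_num), mul_one_div_cancel hj0.ne', Real.rpow_one]
    have hC0 : 0 ≤ C := (Real.rpow_nonneg hN0.le _).trans (hC j hj)
    exact mul_le_mul (hC j hj) hRj (Real.rpow_nonneg hR0.le _) hC0

/-- Linearity: the difference of two germs with equal Taylor series is flat and obeys the bounds
with the constants added. -/
theorem quasiAnalytic_of_forall_chain {K : DCWeight}
    (h : ∀ (F : ℕ → ℝ → ℂ) (r A B : ℝ), 0 < r → 0 < A → 0 < B → IsDerivChain F (Ioo (-r) r) →
      (∀ k, ∀ x ∈ Ioo (-r) r, ‖F k x‖ ≤ (k ! : ℝ) * (A * B ^ k * K.m k)) →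
      (∀ k, F k 0 = 0) → ∀ᶠ x in 𝓝 (0 : ℝ), F 0 x = 0) : K.QuasiAnalytic := by
  intro a ha b hb hab
  obtain ⟨F, r, A, B, hr, hA, hB, hF, hFb, rfl⟩ := K.exists_isDerivChain ha
  obtain ⟨G, r', A', B', hr', hA', hB', hG, hGb, rfl⟩ := K.exists_isDerivChain hb
  have hflat : ∀ k, F k 0 - G k 0 = 0 := by
    intro k
    have h1 := congrArg (PowerSeries.coeff k) hab
    change (PowerSeries.mk fun k => iteratedDeriv k (F 0) 0 / (k ! : ℂ)).coeff k =
      (PowerSeries.mk fun k => iteratedDeriv k (G 0) 0 / (k ! : ℂ)).coeff k at h1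
    have hk : (k ! : ℂ) ≠ 0 := by exact_mod_cast k.factorial_ne_zero
    rw [PowerSeries.coeff_mk, PowerSeries.coeff_mk, div_left_inj' hk,
      hF.iteratedDeriv_eq isOpen_Ioo k (by simpa using hr),
      hG.iteratedDeriv_eq isOpen_Ioo k (by simpa using hr')] at h1
    exact sub_eq_zero.2 h1
  have hsub : Ioo (-min r r') (min r r') ⊆ Ioo (-r) r :=
    Ioo_subset_Ioo (neg_le_neg (min_le_left _ _)) (min_le_left _ _)
  have hsub' : Ioo (-min r r') (min r r') ⊆ Ioo (-r') r' :=
    Ioo_subset_Ioo (neg_le_neg (min_le_right _ _)) (min_le_right _ _)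
  have := h (fun k x => F k x - G k x) (min r r') (A + A') (B + B') (lt_min hr hr')
    (by positivity) (by positivity) ((hF.mono hsub).sub (hG.mono hsub'))
    (fun k x hx => by
      have hm := K.pos k
      calc _ ≤ (k ! : ℝ) * (A * B ^ k * K.m k) + (k ! : ℝ) * (A' * B' ^ k * K.m k) :=
            (norm_sub_le _ _).trans (add_le_add (hFb k x (hsub hx)) (hGb k x (hsub' hx)))
        _ ≤ (k ! : ℝ) * (A * (B + B') ^ k * K.m k) +
            (k ! : ℝ) * (A' * (B + B') ^ k * K.m k) := by gcongr <;> linarith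
        _ = _ := by ring)
    hflat
  exact Germ.coe_eq.2 (this.mono fun x hx => sub_eq_zero.1 hx)

/-- A quasi-analytic class can be enlarged by an unbounded factor in the ratios of its weight
without losing quasi-analyticity. -/
theorem QuasiAnalytic.exists_mulRatio {N : DCWeight} (hN : N.QuasiAnalytic) :
    ∃ (R : ℕ → ℝ) (hR : Monotone R) (h1 : ∀ k, 1 ≤ R k) (h2 : ∀ k, R k ≤ k + 1),
      Tendsto R atTop atTop ∧ (N.mulRatio R hR h1 h2).QuasiAnalytic := by
  -- In `(j + 1) ^ 2` one factor is for the constant `B` of the function, the other for the partial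
  -- products of `R`.
  have hL := fun j : ℕ => hN.exists_order (b := ((j : ℝ) + 1) ^ 2) (η := 1 / ((j : ℝ) + 1))
    (by positivity) (by positivity)
  choose L' hL' using hL
  obtain ⟨R, hR, h1, h2, htop, hprod⟩ := exists_slowly_tendsto_atTop L'
  refine ⟨R, hR, h1, h2, htop, ?_⟩
  refine quasiAnalytic_of_forall_chain fun F r A B hr hA hB hF hFb hflat => ?_
  -- Rescaling to `(-1, 1)` with `a ≤ 1` does not worsen the derivative bounds; dividing by `A`
  -- removes the leading constant.
  set a : ℝ := min r 1
  have ha : 0 < a := lt_min hr one_pos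
  have ha1 : a ≤ 1 := min_le_right _ _
  have hst : ∀ x ∈ Ioo (-1 : ℝ) 1, a * x + 0 ∈ Ioo (-r) r := by
    intro x hx
    have har : a ≤ r := min_le_left _ _
    constructor <;> nlinarith [hx.1, hx.2]
  have hG := hF.comp_affine a 0 ((1 / A : ℝ) : ℂ) hst
  have hsmall : ∀ j : ℕ, B ≤ j + 1 → ∀ x ∈ Icc (-1 / 2 : ℝ) (1 / 2),
      ‖((1 / A : ℝ) : ℂ) * ((a : ℂ) ^ 0 * F 0 (a * x + 0))‖ ≤ 1 / ((j : ℝ) + 1) := by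
    intro j hj
    refine hL' j _ hG (fun k hk x hx => ?_) (fun k _ => by simp [hflat])
    have hprod := hprod j k hk
    have hp : 0 < ∏ i ∈ Finset.range k, R i :=
      Finset.prod_pos fun i _ => one_pos.trans_le (h1 i)
    have hm := N.pos k
    have hF' := hFb k _ (hst x hx)
    rw [norm_mul, norm_mul, norm_pow, Complex.norm_real, Complex.norm_real,
      Real.norm_of_nonneg ha.le, Real.norm_of_nonneg (by positivity)]
    calc 1 / A * (a ^ k * ‖F k (a * x + 0)‖)
        ≤ 1 / A * (1 ^ k * ((k ! : ℝ) *
          (A * B ^ k * (N.m k * ∏ i ∈ Finset.range k, R i)))) := by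
          gcongr
          exact hF'
      _ = (k ! : ℝ) * ((B ^ k * ∏ i ∈ Finset.range k, R i) * N.m k) := by
          field_simp
          simp
      _ ≤ (k ! : ℝ) * ((((j : ℝ) + 1) ^ k * ((j : ℝ) + 1) ^ k) * N.m k) := by gcongr
      _ = _ := by rw [← mul_pow, sq]
  have hzero : ∀ x ∈ Icc (-1 / 2 : ℝ) (1 / 2), F 0 (a * x) = 0 := by
    intro x hx
    have hle : ‖((1 / A : ℝ) : ℂ) * ((a : ℂ) ^ 0 * F 0 (a * x + 0))‖ ≤ 0 := by
      refine ge_of_tendsto tendsto_one_div_add_atTop_nhds_zero_nat ?_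
      obtain ⟨n, hn⟩ := exists_nat_ge B
      filter_upwards [eventually_ge_atTop n] with j hj
      refine hsmall j ?_ x hx
      have : (n : ℝ) ≤ j := by exact_mod_cast hj
      linarith
    have := norm_le_zero_iff.1 hle
    simpa [hA.ne'] using this
  have hnhds : Icc (-(a / 2)) (a / 2) ∈ 𝓝 (0 : ℝ) := Icc_mem_nhds (by linarith) (by linarith)
  filter_upwards [hnhds] with x hx
  have := hzero (x / a) ⟨by rw [le_div_iff₀ ha]; linarith [hx.1],
    by rw [div_le_iff₀ ha]; linarith [hx.2]⟩
  rwa [mul_div_cancel₀ _ ha.ne'] at this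

end DCWeight

/-! ### Analytic germs and bounded ratios -/

/-- A real analytic function extends to a holomorphic one. -/
theorem AnalyticAt.exists_complex_extension {f : ℝ → ℂ} (hf : AnalyticAt ℝ f 0) :
    ∃ g : ℂ → ℂ, AnalyticAt ℂ g 0 ∧ ∀ᶠ x : ℝ in 𝓝 0, f x = g x := by
  obtain ⟨p, hp⟩ := hf
  rw [hasFPowerSeriesAt_iff] at hp
  simp only [zero_add] at hp
  obtain ⟨r, hr, hp'⟩ := Metric.eventually_nhds_iff.1 hp
  have hr2 : 0 < r / 2 := by positivity
  have hsum := (hp' (y := r / 2) (by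
    rw [Real.dist_eq, sub_zero, abs_of_pos hr2]
    linarith)).summable
  obtain ⟨C, hC⟩ := (Metric.isBounded_range_of_tendsto _ hsum.tendsto_atTop_zero).exists_norm_le
  have hC' : ∀ n, (r / 2) ^ n * ‖p.coeff n‖ ≤ C := fun n => by
    have := hC _ (mem_range_self n)
    rwa [norm_smul, norm_pow, Real.norm_of_nonneg hr2.le] at this
  set q : FormalMultilinearSeries ℂ ℂ ℂ := FormalMultilinearSeries.ofScalars ℂ fun n => p.coeff n
  have hq : ∀ n, q.coeff n = p.coeff n := fun n => by
    simp [q]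
  refine ⟨fun z => ∑' n, z ^ n * p.coeff n, ⟨q, ?_⟩, ?_⟩
  · rw [hasFPowerSeriesAt_iff]
    filter_upwards [Metric.ball_mem_nhds (0 : ℂ) hr2] with z hz
    have hz' : ‖z‖ < r / 2 := by simpa using hz
    simp only [hq, zero_add, smul_eq_mul]
    refine Summable.hasSum ?_
    refine Summable.of_norm_bounded (g := fun n => C * (‖z‖ / (r / 2)) ^ n)
      ((summable_geometric_of_lt_one (by positivity) ((div_lt_one hr2).2 hz')).mul_left C)
      fun n => ?_
    calc ‖z ^ n * p.coeff n‖ = ((r / 2) ^ n * ‖p.coeff n‖) * (‖z‖ / (r / 2)) ^ n := by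
          rw [norm_mul, norm_pow, mul_right_comm, ← mul_pow, mul_div_cancel₀ _ hr2.ne']
      _ ≤ _ := by gcongr; exact hC' n
  · filter_upwards [hp] with x hx
    rw [← hx.tsum_eq]
    simp

/-- Cauchy's estimates for the holomorphic extension, on circles of radius `ρ / 4` about points
within `ρ / 4` of the origin. -/
theorem AnalyticAt.exists_isDerivChain {f : ℝ → ℂ} (hf : AnalyticAt ℝ f 0) :
    ∃ (F : ℕ → ℝ → ℂ) (r A B : ℝ), 0 < r ∧ 0 < A ∧ 0 < B ∧ IsDerivChain F (Ioo (-r) r) ∧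
      (∀ k, ∀ x ∈ Ioo (-r) r, ‖F k x‖ ≤ (k ! : ℝ) * (A * B ^ k)) ∧ F 0 =ᶠ[𝓝 0] f := by
  obtain ⟨g, hg, hfg⟩ := hf.exists_complex_extension
  obtain ⟨ρ, hρ, hgρ⟩ := hg.exists_ball_analyticOnNhd
  have hsub : Metric.closedBall (0 : ℂ) (ρ / 2) ⊆ Metric.ball 0 ρ :=
    Metric.closedBall_subset_ball (by linarith)
  obtain ⟨C, hC⟩ := (isCompact_closedBall (0 : ℂ) (ρ / 2)).exists_bound_of_continuousOn
    (hgρ.continuousOn.mono hsub)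
  have hmem : ∀ x ∈ Ioo (-(ρ / 4)) (ρ / 4), ‖(x : ℂ)‖ < ρ / 4 := fun x hx => by
    rw [Complex.norm_real, Real.norm_eq_abs]
    exact abs_lt.2 hx
  have hr4 : 0 < ρ / 4 := by positivity
  refine ⟨fun k x => iteratedDeriv k g x, ρ / 4, |C| + 1, 1 / (ρ / 4), hr4,
    by positivity, by positivity, ?_, ?_, ?_⟩
  · intro k x hx
    have hx' : (x : ℂ) ∈ Metric.ball (0 : ℂ) ρ := by
      have := hmem x hx
      simp only [mem_ball_zero_iff]
      linarith
    have h1 : DifferentiableAt ℂ (iteratedDeriv k g) x := by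
      rw [iteratedDeriv_eq_iterate]
      exact ((hgρ x hx').iterated_deriv k).differentiableAt
    have h2 := h1.hasDerivAt
    rw [← iteratedDeriv_succ] at h2
    exact h2.comp_ofReal.hasDerivWithinAt
  · intro k x hx
    have hx' := hmem x hx
    have hball : Metric.closedBall (x : ℂ) (ρ / 4) ⊆ Metric.closedBall 0 (ρ / 2) := by
      refine Metric.closedBall_subset_closedBall' ?_
      rw [dist_zero_right]
      linarith
    have hd : DiffContOnCl ℂ g (Metric.ball (x : ℂ) (ρ / 4)) := by
      refine (hgρ.differentiableOn.mono ?_).diffContOnCl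
      exact Metric.closure_ball_subset_closedBall.trans (hball.trans hsub)
    refine (Complex.norm_iteratedDeriv_le_of_forall_mem_sphere_norm_le k hr4 hd
      fun z hz => ((hC z (hball (Metric.sphere_subset_closedBall hz))).trans
        (by linarith [le_abs_self C]) : ‖g z‖ ≤ |C| + 1)).trans_eq ?_
    rw [one_div, inv_pow]
    ring
  · filter_upwards [hfg] with x hx
    simp [hx]

namespace IsDerivChain

variable {F : ℕ → ℝ → ℂ} {r A B : ℝ}

/-- The Taylor remainder of order `n` is at most `A (n + 1) (B x) ^ (n + 1)`; the factor `n + 1`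
comes from a remainder bound with `n!` in the denominator, and is harmless for `B x < 1`. -/
theorem hasSum_taylor_of_nonneg (hF : IsDerivChain F (Ioo (-r) r)) (hB : 0 ≤ B)
    (hb : ∀ k, ∀ x ∈ Ioo (-r) r, ‖F k x‖ ≤ (k ! : ℝ) * (A * B ^ k)) {x : ℝ} (hx0 : 0 ≤ x)
    (hxr : x < r) (hBx : B * x < 1) :
    HasSum (fun k => (x : ℂ) ^ k * (F k 0 / (k ! : ℂ))) (F 0 x) := by
  rcases hx0.eq_or_lt with rfl | hx
  · convert hasSum_single (f := fun k => ((0 : ℝ) : ℂ) ^ k * (F k 0 / (k ! : ℂ))) 0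
      (fun k hk => by simp [hk]) using 1
    simp
  have hsub : Icc 0 x ⊆ Ioo (-r) r := fun t ht => ⟨by linarith [ht.1], by linarith [ht.2]⟩
  have h0 : (0 : ℝ) ∈ Ioo (-r) r := hsub (left_mem_Icc.2 hx0)
  have hBx0 : 0 ≤ B * x := by positivity
  have hsum : Summable fun k => (x : ℂ) ^ k * (F k 0 / (k ! : ℂ)) := by
    refine Summable.of_norm_bounded (g := fun k => A * (B * x) ^ k)
      ((summable_geometric_of_lt_one hBx0 hBx).mul_left A) fun k => ?_
    have hk : (0 : ℝ) < k ! := by exact_mod_cast k.factorial_pos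
    rw [norm_mul, norm_pow, norm_div, Complex.norm_real, Real.norm_of_nonneg hx0,
      Complex.norm_natCast, mul_pow]
    calc x ^ k * (‖F k 0‖ / k !) ≤ x ^ k * ((k ! : ℝ) * (A * B ^ k) / k !) := by
          gcongr
          exact hb k 0 h0
      _ = _ := by field_simp
  rw [hsum.hasSum_iff_tendsto_nat]
  rw [← tendsto_add_atTop_iff_nat 1, tendsto_iff_norm_sub_tendsto_zero]
  have hc := hF.mono hsub
  have hu : UniqueDiffOn ℝ (Icc 0 x) := uniqueDiffOn_Icc hx
  have hbound : ∀ n : ℕ, ‖∑ k ∈ Finset.range (n + 1), (x : ℂ) ^ k * (F k 0 / (k ! : ℂ)) - F 0 x‖ ≤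
      A * (((n : ℝ) + 1) * (B * x) ^ (n + 1)) := by
    intro n
    have hT := taylor_mean_remainder_bound (f := F 0) (n := n)
      (C := ((n + 1)! : ℝ) * (A * B ^ (n + 1))) hx0
      ((hc.contDiffOn hu).of_le (by exact_mod_cast le_top)) (right_mem_Icc.2 hx0)
      (fun y hy => by
        rw [hc.iteratedDerivWithin_eq hu (n + 1) hy]
        exact hb (n + 1) y (hsub hy))
    rw [norm_sub_rev]
    have e : taylorWithinEval (F 0) n (Icc 0 x) 0 x =
        ∑ k ∈ Finset.range (n + 1), (x : ℂ) ^ k * (F k 0 / (k ! : ℂ)) := by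
      rw [taylor_within_apply]
      refine Finset.sum_congr rfl fun k _ => ?_
      rw [hc.iteratedDerivWithin_eq hu k (left_mem_Icc.2 hx0), Complex.real_smul]
      push_cast
      rw [sub_zero]
      ring
    rw [e] at hT
    refine hT.trans_eq ?_
    rw [Nat.factorial_succ, sub_zero]
    have hk : (n ! : ℝ) ≠ 0 := by exact_mod_cast n.factorial_ne_zero
    push_cast
    rw [mul_pow]
    field_simp
  have hlim : Tendsto (fun n : ℕ => A * (((n : ℝ) + 1) * (B * x) ^ (n + 1))) atTop (𝓝 0) := by
    have := (tendsto_self_mul_const_pow_of_lt_one hBx0 hBx).comp (tendsto_add_atTop_nat 1)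
    simpa using this.const_mul A
  exact squeeze_zero (fun _ => norm_nonneg _) hbound hlim

theorem hasSum_taylor (hF : IsDerivChain F (Ioo (-r) r)) (hB : 0 ≤ B)
    (hb : ∀ k, ∀ x ∈ Ioo (-r) r, ‖F k x‖ ≤ (k ! : ℝ) * (A * B ^ k)) {x : ℝ}
    (hxr : |x| < r) (hBx : B * |x| < 1) :
    HasSum (fun k => (x : ℂ) ^ k * (F k 0 / (k ! : ℂ))) (F 0 x) := by
  rcases le_total 0 x with h | h
  · rw [abs_of_nonneg h] at hxr hBx
    exact hF.hasSum_taylor_of_nonneg hB hb h hxr hBx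
  · rw [abs_of_nonpos h] at hxr hBx
    -- Negative `x` is reduced to the previous case by reflection.
    have hst : ∀ y ∈ Ioo (-r) r, (-1) * y + 0 ∈ Ioo (-r) r := fun y hy =>
      ⟨by linarith [hy.2], by linarith [hy.1]⟩
    have hG := hF.comp_affine (-1) 0 1 hst
    have := hG.hasSum_taylor_of_nonneg hB (fun k y hy => by
      simpa using hb k _ (hst y hy)) (x := -x) (by linarith) hxr hBx
    convert this using 1
    · funext k
      have e : (x : ℂ) ^ k = (-x : ℂ) ^ k * (-1) ^ k := by rw [← mul_pow]; simp
      push_cast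
      rw [e]
      simp
      ring
    · simp

theorem analyticAt (hF : IsDerivChain F (Ioo (-r) r)) (hr : 0 < r) (hB : 0 ≤ B)
    (hb : ∀ k, ∀ x ∈ Ioo (-r) r, ‖F k x‖ ≤ (k ! : ℝ) * (A * B ^ k)) :
    AnalyticAt ℝ (F 0) 0 := by
  let p : FormalMultilinearSeries ℝ ℝ ℂ := fun k =>
    ContinuousMultilinearMap.mkPiRing ℝ (Fin k) (F k 0 / (k ! : ℂ))
  refine ⟨p, ?_⟩
  rw [hasFPowerSeriesAt_iff]
  have h1 : ∀ᶠ x : ℝ in 𝓝 0, |x| < r :=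
    (continuous_abs.tendsto' 0 0 abs_zero).eventually_lt_const hr
  have h2 : ∀ᶠ x : ℝ in 𝓝 0, B * |x| < 1 := by
    have hc : Continuous fun x : ℝ => B * |x| := by fun_prop
    exact (hc.tendsto' 0 0 (by simp)).eventually_lt_const one_pos
  filter_upwards [h1, h2] with x hx1 hx2
  have := hF.hasSum_taylor hB hb hx1 hx2
  simpa [p, FormalMultilinearSeries.coeff] using this

end IsDerivChain

namespace DCWeight

theorem analyticGermRing_le (M : DCWeight) : analyticGermRing ≤ M.germRing := by
  rintro _ ⟨f, hf, rfl⟩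
  obtain ⟨F, r, A, B, hr, hA, hB, hF, hb, hfF⟩ := hf.exists_isDerivChain
  rw [← Germ.coe_eq.2 hfF]
  refine M.mem_germRing hF isOpen_Ioo (by simpa using hr) hA hB fun k x hx => ?_
  refine (hb k x hx).trans ?_
  exact mul_le_mul_of_nonneg_left (le_mul_of_one_le_right (by positivity) (M.one_le k))
    (by positivity)

theorem m_le_pow (M : DCWeight) {C : ℝ} (hC : ∀ j, M.m (j + 1) / M.m j ≤ C) (k : ℕ) :
    M.m k ≤ C ^ k := by
  induction k with
  | zero => simp [M.zero]
  | succ k ih =>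
    have h0 : 0 < C := one_pos.trans_le ((M.one_le_ratio k).trans (hC k))
    have := (div_le_iff₀ (M.pos k)).1 (hC k)
    calc M.m (k + 1) ≤ C * M.m k := this
      _ ≤ C * C ^ k := by gcongr
      _ = C ^ (k + 1) := by ring

/-- The ratios are monotone, so otherwise they are bounded. Then `m k` is at most geometric, and
every germ in the class is analytic. -/
theorem tendsto_ratio (M : DCWeight) (hM : analyticGermRing < M.germRing) :
    Tendsto (fun j => M.m (j + 1) / M.m j) atTop atTop := by
  rcases tendsto_atTop_of_monotone M.monotone_ratio with h | ⟨C, hC⟩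
  · exact h
  refine absurd (fun a ha => ?_) hM.not_ge
  have hm := M.m_le_pow fun j => M.monotone_ratio.ge_of_tendsto hC j
  have hC0 : 0 ≤ C :=
    zero_le_one.trans ((M.one_le_ratio 0).trans (M.monotone_ratio.ge_of_tendsto hC 0))
  obtain ⟨F, r, A, B, hr, hA, hB, hF, hb, rfl⟩ := M.exists_isDerivChain ha
  refine ⟨F 0, hF.analyticAt (A := A) hr (mul_nonneg hB.le hC0) fun k x hx => ?_, rfl⟩
  refine (hb k x hx).trans ?_
  rw [mul_pow, ← mul_assoc A]
  gcongr
  exact hm k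

end DCWeight

/-! ### Choosing a pole -/

theorem one_le_prod_range {R : ℕ → ℝ} (h1 : ∀ k, 1 ≤ R k) (k : ℕ) :
    1 ≤ ∏ i ∈ Finset.range k, R i := by
  induction k with
  | zero => simp
  | succ k ih =>
    rw [Finset.prod_range_succ]
    exact one_le_mul_of_one_le_of_one_le ih (h1 k)

/-- All factors from some index `n` on are at least `D`, so `C = D ^ n` pays for the earlier ones.
-/
theorem exists_pow_le_mul_prod {R : ℕ → ℝ} (h1 : ∀ k, 1 ≤ R k) (hR : Tendsto R atTop atTop)
    {D : ℝ} (hD : 1 ≤ D) :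
    ∃ C : ℝ, 0 < C ∧ ∀ k, D ^ k ≤ C * ∏ i ∈ Finset.range k, R i := by
  obtain ⟨n, hn⟩ := eventually_atTop.1 (hR.eventually_ge_atTop D)
  have hD0 : 0 < D := one_pos.trans_le hD
  have hp := one_le_prod_range h1
  refine ⟨D ^ n, by positivity, fun k => ?_⟩
  induction k with
  | zero => simpa using one_le_pow₀ hD
  | succ k ih =>
    rcases lt_or_ge k n with h | h
    · exact (pow_le_pow_right₀ hD h).trans (le_mul_of_one_le_right (by positivity) (hp _))
    · rw [pow_succ, Finset.prod_range_succ, ← mul_assoc]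
      have := one_pos.trans_le (hp k)
      exact mul_le_mul ih (hn k h) hD0.le (by positivity)

namespace DCWeight

theorem prod_ratio (M : DCWeight) (k : ℕ) :
    ∏ i ∈ Finset.range k, M.m (i + 1) / M.m i = M.m k := by
  induction k with
  | zero => simp [M.zero]
  | succ k ih =>
    rw [Finset.prod_range_succ, ih, mul_div_cancel₀ _ (M.pos k).ne']

/-- A log-convex sequence lies above its tangent lines. -/
theorem mul_ratio_pow_le (K : DCWeight) (k i : ℕ) :
    K.m k * (K.m (k + 1) / K.m k) ^ i ≤ K.m i * (K.m (k + 1) / K.m k) ^ k := by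
  set κ := K.m (k + 1) / K.m k with hκ
  have hκ0 : 0 < κ := one_pos.trans_le (K.one_le_ratio k)
  have hstep : ∀ i, K.m (i + 1) = K.m (i + 1) / K.m i * K.m i := fun i =>
    (div_mul_cancel₀ _ (K.pos i).ne').symm
  rcases le_total k i with h | h
  · induction i, h using Nat.le_induction with
    | base => exact le_rfl
    | succ i hi ih =>
      have h2 : κ ≤ K.m (i + 1) / K.m i := K.monotone_ratio hi
      have := K.pos i
      calc K.m k * κ ^ (i + 1) = κ * (K.m k * κ ^ i) := by ring
        _ ≤ κ * (K.m i * κ ^ k) := by gcongr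
        _ ≤ K.m (i + 1) / K.m i * (K.m i * κ ^ k) := by gcongr
        _ = K.m (i + 1) / K.m i * K.m i * κ ^ k := by ring
        _ = _ := by rw [← hstep i]
  · induction h using Nat.decreasingInduction with
    | self => exact le_rfl
    | of_succ i hi ih =>
      have h2 : K.m (i + 1) / K.m i ≤ κ := K.monotone_ratio hi.le
      have := K.pos i
      refine le_of_mul_le_mul_left ?_ hκ0
      calc κ * (K.m k * κ ^ i) = K.m k * κ ^ (i + 1) := by ring
        _ ≤ K.m (i + 1) * κ ^ k := ih
        _ = K.m (i + 1) / K.m i * K.m i * κ ^ k := by rw [← hstep i]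
        _ ≤ κ * K.m i * κ ^ k := by gcongr
        _ = _ := by ring

/-- If the ratios of `M` and `K` tend to infinity and `K` is much larger than `N`, then there is
a pole of strength `c` which obeys the `K`-bounds at distance `ε` and the `M`-bounds at a given
distance `δ`, but violates the `N`-bounds at distance `ε`. -/
theorem exists_pole {M N K : DCWeight}
    (hM : Tendsto (fun j => M.m (j + 1) / M.m j) atTop atTop)
    (hK : Tendsto (fun j => K.m (j + 1) / K.m j) atTop atTop)
    (hNK : ∀ D : ℝ, 1 ≤ D → ∃ C : ℝ, 0 < C ∧ ∀ k, D ^ k * N.m k ≤ C * K.m k)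
    {δ D : ℝ} (hδ : 0 < δ) (hδ1 : δ ≤ 1) (hD : 1 ≤ D) :
    ∃ ε c : ℝ, 0 < ε ∧ 0 < c ∧ c ≤ 1 ∧ (∀ k, c / ε ^ (k + 1) ≤ K.m k) ∧
      (∀ k, c / δ ^ (k + 1) ≤ M.m k) ∧ ∃ k, D ^ (k + 1) * N.m k ≤ c / ε ^ (k + 1) := by
  obtain ⟨C, hC, hCM⟩ := exists_pow_le_mul_prod M.one_le_ratio hM (one_le_inv₀ hδ |>.2 hδ1)
  -- The extra factor `2` leaves `2 ^ k` to absorb `C' * D`.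
  obtain ⟨C', hC', hCN⟩ := hNK (2 * D) (by linarith)
  obtain ⟨k, hk1, hk2⟩ := ((hK.eventually_ge_atTop (C / δ)).and
    ((tendsto_pow_atTop_atTop_of_one_lt (one_lt_two (α := ℝ))).eventually_ge_atTop
      (C' * D))).exists
  set κ := K.m (k + 1) / K.m k
  have hκ1 : 1 ≤ κ := K.one_le_ratio k
  have hκ0 : 0 < κ := one_pos.trans_le hκ1
  have hKk := K.pos k
  -- The tangent inequality at index `0`. With `κ ≥ C / δ` it makes the strength small enough for
  -- the `M`-bounds.
  have hc : K.m k / κ ^ (k + 1) ≤ 1 / κ := by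
    have := K.mul_ratio_pow_le k 0
    rw [pow_zero, mul_one, K.zero, one_mul] at this
    rw [div_le_div_iff₀ (by positivity) hκ0, one_mul, pow_succ]
    gcongr
  -- With `ε = κ⁻¹` the quantities `c / ε ^ (i + 1)` form the geometric sequence tangent to `K.m` at
  -- `k`: below `K.m i` for all `i`, equal to it at `i = k`.
  have he : ∀ i, K.m k / κ ^ (k + 1) / κ⁻¹ ^ (i + 1) = K.m k * κ ^ i / κ ^ k := fun i => by
    rw [inv_pow, div_inv_eq_mul, pow_succ, pow_succ]
    field_simp
  refine ⟨κ⁻¹, K.m k / κ ^ (k + 1), by positivity, by positivity, hc.trans ?_, fun i => ?_,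
    fun i => ?_, k, ?_⟩
  · exact (div_le_one hκ0).2 hκ1
  · rw [he, div_le_iff₀ (by positivity)]
    exact K.mul_ratio_pow_le k i
  · have h1 : K.m k / κ ^ (k + 1) ≤ δ / C := by
      refine hc.trans ?_
      rw [div_le_div_iff₀ hκ0 hC, one_mul]
      rwa [div_le_iff₀ hδ, mul_comm] at hk1
    have h2 := hCM i
    rw [M.prod_ratio] at h2
    calc K.m k / κ ^ (k + 1) / δ ^ (i + 1) ≤ δ / C / δ ^ (i + 1) := by gcongr
      _ = δ⁻¹ ^ i / C := by
        rw [inv_pow, pow_succ]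
        field_simp
      _ ≤ M.m i := by
        rw [div_le_iff₀ hC, mul_comm]
        exact h2
  · rw [he, mul_div_cancel_right₀ _ (by positivity)]
    have h3 := hCN k
    have hN := N.pos k
    refine le_of_mul_le_mul_left ?_ hC'
    calc C' * (D ^ (k + 1) * N.m k) = C' * D * (D ^ k * N.m k) := by ring
      _ ≤ 2 ^ k * (D ^ k * N.m k) := by gcongr
      _ = (2 * D) ^ k * N.m k := by rw [mul_pow]; ring
      _ ≤ _ := h3

end DCWeight

/-! ### Series of simple poles -/

/-- The `k`-th derivative of `x ↦ 1 / (x - z)`. -/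
noncomputable def poleTerm (z : ℂ) (k : ℕ) (x : ℝ) : ℂ :=
  (-1) ^ k * (k ! : ℂ) / ((x : ℂ) - z) ^ (k + 1)

theorem norm_poleTerm (z : ℂ) (k : ℕ) (x : ℝ) :
    ‖poleTerm z k x‖ = (k ! : ℝ) / ‖(x : ℂ) - z‖ ^ (k + 1) := by
  simp [poleTerm]

theorem hasDerivAt_poleTerm {z : ℂ} (k : ℕ) {x : ℝ} (h : (x : ℂ) - z ≠ 0) :
    HasDerivAt (poleTerm z k) (poleTerm z (k + 1) x) x := by
  have h1 : HasDerivAt (fun y : ℂ => y - z) 1 (x : ℂ) := (hasDerivAt_id _).sub_const z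
  have h2 := ((h1.pow (k + 1)).fun_inv (pow_ne_zero _ h)).const_mul ((-1) ^ k * (k ! : ℂ))
  have h3 := h2.comp_ofReal
  refine h3.congr_deriv ?_
  simp only [poleTerm, Nat.factorial_succ, Pi.pow_apply]
  push_cast
  field_simp
  ring

/-- The `k`-th derivative of a series of simple fractions. -/
noncomputable def poleSum (w : ℕ → ℝ) (z : ℕ → ℂ) (k : ℕ) (x : ℝ) : ℂ :=
  ∑' j, (w j : ℂ) * poleTerm (z j) k x

theorem norm_poleTerm_mul_le {w t d : ℝ} {z : ℂ} {k : ℕ} {x : ℝ} (hw : 0 ≤ w) (hd : 0 < d)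
    (hx : d ≤ ‖(x : ℂ) - z‖) (ht : w / d ^ (k + 1) ≤ t) :
    ‖(w : ℂ) * poleTerm z k x‖ ≤ (k ! : ℝ) * t := by
  rw [norm_mul, norm_poleTerm, Complex.norm_real, Real.norm_of_nonneg hw]
  calc w * ((k ! : ℝ) / ‖(x : ℂ) - z‖ ^ (k + 1)) ≤ w * ((k ! : ℝ) / d ^ (k + 1)) := by gcongr
    _ = (k ! : ℝ) * (w / d ^ (k + 1)) := by ring
    _ ≤ _ := by gcongr

section PoleSum

variable {c δ ε : ℕ → ℝ}

/-- The weights `2⁻ʲ cⱼ`. -/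
noncomputable def dyadicWeight (c : ℕ → ℝ) (j : ℕ) : ℝ := (1 / 2) ^ j * c j

theorem norm_dyadic_poleTerm_le {t d : ℝ} {z : ℂ} {j k : ℕ} {x : ℝ} (hc : 0 ≤ c j) (hd : 0 < d)
    (hx : d ≤ ‖(x : ℂ) - z‖) (ht : c j / d ^ (k + 1) ≤ t) :
    ‖(dyadicWeight c j : ℂ) * poleTerm z k x‖ ≤ (1 / 2) ^ j * ((k ! : ℝ) * t) := by
  have := norm_poleTerm_mul_le (t := (1 / 2) ^ j * t) (k := k)
    (show 0 ≤ dyadicWeight c j by unfold dyadicWeight; positivity) hd hx (by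
      rw [dyadicWeight, mul_div_assoc]
      gcongr)
  exact this.trans_eq (by ring)

theorem hasSum_dyadic (a : ℝ) : HasSum (fun j : ℕ => (1 / 2 : ℝ) ^ j * a) (2 * a) :=
  hasSum_geometric_two.mul_right a

/-- Poles `-δⱼ + i εⱼ`. -/
noncomputable def pole (δ ε : ℕ → ℝ) (j : ℕ) : ℂ := ⟨-δ j, ε j⟩

theorem le_norm_sub_pole_im (j : ℕ) (x : ℝ) : ε j ≤ ‖(x : ℂ) - pole δ ε j‖ := by
  have := Complex.abs_im_le_norm ((x : ℂ) - pole δ ε j)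
  simp only [pole, Complex.sub_im, Complex.ofReal_im, zero_sub, abs_neg] at this
  exact (le_abs_self _).trans this

theorem le_norm_sub_pole_re (j : ℕ) (x : ℝ) : |x + δ j| ≤ ‖(x : ℂ) - pole δ ε j‖ := by
  have := Complex.abs_re_le_norm ((x : ℂ) - pole δ ε j)
  simpa [pole] using this

variable {K M : DCWeight}

theorem norm_dyadic_pole_le (hc : ∀ j, 0 < c j) (hε : ∀ j, 0 < ε j)
    (hK : ∀ j k, c j / ε j ^ (k + 1) ≤ K.m k) (k : ℕ) (x : ℝ) (j : ℕ) :
    ‖(dyadicWeight c j : ℂ) * poleTerm (pole δ ε j) k x‖ ≤ (1 / 2) ^ j * ((k ! : ℝ) * K.m k) :=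
  norm_dyadic_poleTerm_le (hc j).le (hε j) (le_norm_sub_pole_im j x) (hK j k)

theorem summable_dyadic_pole (hc : ∀ j, 0 < c j) (hε : ∀ j, 0 < ε j)
    (hK : ∀ j k, c j / ε j ^ (k + 1) ≤ K.m k) (k : ℕ) (x : ℝ) :
    Summable fun j => (dyadicWeight c j : ℂ) * poleTerm (pole δ ε j) k x :=
  (hasSum_dyadic _).summable.of_norm_bounded (norm_dyadic_pole_le hc hε hK k x)

theorem isDerivChain_poleSum (hc : ∀ j, 0 < c j) (hε : ∀ j, 0 < ε j)
    (hK : ∀ j k, c j / ε j ^ (k + 1) ≤ K.m k) :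
    IsDerivChain (poleSum (dyadicWeight c) (pole δ ε)) univ := by
  intro k x _
  refine (hasDerivAt_tsum (𝕜 := ℝ) (hasSum_dyadic ((k + 1)! * K.m (k + 1))).summable
    (fun j y => (hasDerivAt_poleTerm k ?_).const_mul _)
    (fun j y => norm_dyadic_pole_le hc hε hK (k + 1) y j)
    (summable_dyadic_pole hc hε hK k 0) x).hasDerivWithinAt
  exact norm_pos_iff.1 ((hε j).trans_le (le_norm_sub_pole_im j y))

theorem norm_poleSum_le (hc : ∀ j, 0 < c j) (hε : ∀ j, 0 < ε j)
    (hK : ∀ j k, c j / ε j ^ (k + 1) ≤ K.m k) (k : ℕ) (x : ℝ) :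
    ‖poleSum (dyadicWeight c) (pole δ ε) k x‖ ≤ (k ! : ℝ) * (2 * 1 ^ k * K.m k) :=
  (tsum_of_norm_bounded (hasSum_dyadic _) (norm_dyadic_pole_le hc hε hK k x)).trans_eq (by ring)

/-- Right of the origin the real parts alone keep `x` at distance at least `δ j` from the pole,
however small `ε j` is. -/
theorem norm_poleSum_le_of_nonneg (hc : ∀ j, 0 < c j) (hδ : ∀ j, 0 < δ j)
    (hM : ∀ j k, c j / δ j ^ (k + 1) ≤ M.m k) (k : ℕ) {x : ℝ} (hx : 0 ≤ x) :
    ‖poleSum (dyadicWeight c) (pole δ ε) k x‖ ≤ (k ! : ℝ) * (2 * 1 ^ k * M.m k) := by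
  refine (tsum_of_norm_bounded (hasSum_dyadic ((k ! : ℝ) * M.m k)) fun j => ?_).trans_eq (by ring)
  refine norm_dyadic_poleTerm_le (hc j).le (hδ j) (le_trans ?_ (le_norm_sub_pole_re j x)) (hM j k)
  exact le_trans (by linarith) (le_abs_self _)

/-- Next to a pole isolated at distance `X⁻¹`, the contribution of that pole dominates. -/
theorem le_norm_poleSum (hc : ∀ j, 0 < c j) (hc1 : ∀ j, c j ≤ 1) (hε : ∀ j, 0 < ε j)
    (hK : ∀ j k, c j / ε j ^ (k + 1) ≤ K.m k) (j k : ℕ) {X : ℝ} (hX : 0 < X)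
    (hsep : ∀ i, i ≠ j → X⁻¹ ≤ |δ i - δ j|) :
    (k ! : ℝ) * ((1 / 2) ^ j * (c j / ε j ^ (k + 1)) - 2 * X ^ (k + 1)) ≤
      ‖poleSum (dyadicWeight c) (pole δ ε) k (-δ j)‖ := by
  have hs := summable_dyadic_pole (δ := δ) hc hε hK k (-δ j)
  rw [poleSum, hs.tsum_eq_add_tsum_ite j]
  -- The other poles lie at distance at least `X⁻¹` and have strength at most `1`.
  have h1 : ‖∑' i, ite (i = j) 0
      ((dyadicWeight c i : ℂ) * poleTerm (pole δ ε i) k (-δ j))‖ ≤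
      2 * ((k ! : ℝ) * X ^ (k + 1)) := by
    refine tsum_of_norm_bounded (hasSum_dyadic _) fun i => ?_
    split_ifs with h
    · rw [norm_zero]
      positivity
    · refine norm_dyadic_poleTerm_le (hc i).le (inv_pos.2 hX)
        (le_trans ?_ (le_norm_sub_pole_re i _)) ?_
      · rw [neg_add_eq_sub]
        exact hsep i h
      · rw [inv_pow, div_inv_eq_mul]
        exact mul_le_of_le_one_left (by positivity) (hc1 i)
  -- The point `-δ j` lies directly below the pole, at distance exactly `ε j`.
  have h2 : ‖(dyadicWeight c j : ℂ) * poleTerm (pole δ ε j) k (-δ j)‖ =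
      (k ! : ℝ) * ((1 / 2) ^ j * (c j / ε j ^ (k + 1))) := by
    have hcj := hc j
    have e : ((-δ j : ℝ) : ℂ) - pole δ ε j = -(ε j : ℂ) * Complex.I := by
      apply Complex.ext <;> simp [pole]
    rw [norm_mul, norm_poleTerm, e, Complex.norm_real, dyadicWeight,
      Real.norm_of_nonneg (by positivity), norm_mul, norm_neg, Complex.norm_real,
      Real.norm_of_nonneg (hε j).le, Complex.norm_I]
    ring
  have h3 := norm_sub_le_norm_add ((dyadicWeight c j : ℂ) * poleTerm (pole δ ε j) k (-δ j))
    (∑' i, ite (i = j) 0 ((dyadicWeight c i : ℂ) * poleTerm (pole δ ε i) k (-δ j)))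
  rw [h2] at h3
  linarith

end PoleSum

/-! ### The singular germ -/

/-- The point of the sequence nearest to `1 / (j + 1)` is `1 / (j + 2)`, where equality holds. -/
theorem inv_le_abs_inv_sub_inv (i j : ℕ) (h : i ≠ j) :
    (((j : ℝ) + 1) * (j + 2))⁻¹ ≤ |1 / ((i : ℝ) + 1) - 1 / ((j : ℝ) + 1)| := by
  have e : 1 / ((i : ℝ) + 1) - 1 / ((j : ℝ) + 1) = ((j : ℝ) - i) / ((i + 1) * (j + 1)) := by
    field_simp
    ring
  have hpos : (0 : ℝ) < (i + 1) * (j + 1) := by positivity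
  rw [e, abs_div, abs_of_pos hpos, inv_eq_one_div, div_le_div_iff₀ (by positivity) hpos]
  have hi : (0 : ℝ) ≤ i := i.cast_nonneg
  have hj : (0 : ℝ) ≤ j := j.cast_nonneg
  rcases lt_or_gt_of_ne h with h | h
  · have h' : (i : ℝ) + 1 ≤ j := by exact_mod_cast h
    rw [abs_of_nonneg (by linarith)]
    nlinarith [mul_nonneg hj hj]
  · have h' : (j : ℝ) + 1 ≤ i := by exact_mod_cast h
    rw [abs_of_nonpos (by linarith)]
    nlinarith [mul_nonneg hj (sub_nonneg.2 h'), mul_nonneg (mul_nonneg hj hj) (sub_nonneg.2 h')]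

theorem pow_succ_add_pow_succ_le {a b : ℝ} (ha : 0 ≤ a) (hb : 0 ≤ b) (k : ℕ) :
    a ^ (k + 1) + b ^ (k + 1) ≤ (a + b) ^ (k + 1) := by
  calc a ^ (k + 1) + b ^ (k + 1) = a * a ^ k + b * b ^ k := by ring
    _ ≤ a * (a + b) ^ k + b * (a + b) ^ k := by gcongr <;> linarith
    _ = (a + b) ^ (k + 1) := by ring

namespace DCWeight

/-- In a quasi-analytic class, functions are determined by their right halves. -/
theorem QuasiAnalytic.eventuallyEq_of_restrictPlus {K : DCWeight} (hK : K.QuasiAnalytic)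
    {F G : ℕ → ℝ → ℂ} {r : ℝ} (hr : 0 < r) (hF : IsDerivChain F (Ioo (-r) r))
    (hG : IsDerivChain G (Ioo (-r) r))
    (hFm : ((F 0 : ℝ → ℂ) : Germ (𝓝 (0 : ℝ)) ℂ) ∈ K.germRing)
    (hGm : ((G 0 : ℝ → ℂ) : Germ (𝓝 (0 : ℝ)) ℂ) ∈ K.germRing)
    (h : F 0 =ᶠ[𝓝[≥] (0 : ℝ)] G 0) : F 0 =ᶠ[𝓝 (0 : ℝ)] G 0 := by
  obtain ⟨t, ht, htF⟩ := mem_nhdsGE_iff_exists_Ico_subset.1 h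
  have hu : 0 < min t r := lt_min ht hr
  have hsub : Ico 0 (min t r) ⊆ Ioo (-r) r := fun x hx =>
    ⟨by linarith [hx.1], hx.2.trans_le (min_le_right _ _)⟩
  have h0 : (0 : ℝ) ∈ Ioo (-r) r := by simpa using hr
  have heq : ∀ k, F k 0 = G k 0 := fun k =>
    (hF.mono hsub).eqOn (hG.mono hsub) (uniqueDiffOn_Ico 0 _)
      (fun x hx => htF ⟨hx.1, hx.2.trans_le (min_le_left _ _)⟩) k ⟨le_rfl, hu⟩
  refine Germ.coe_eq.1 (hK hFm hGm ?_)
  ext k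
  change (PowerSeries.mk fun k => iteratedDeriv k (F 0) 0 / (k ! : ℂ)).coeff k =
    (PowerSeries.mk fun k => iteratedDeriv k (G 0) 0 / (k ! : ℂ)).coeff k
  rw [PowerSeries.coeff_mk, PowerSeries.coeff_mk, hF.iteratedDeriv_eq isOpen_Ioo k h0,
    hG.iteratedDeriv_eq isOpen_Ioo k h0, heq]

theorem germRing_mono {M N : DCWeight} (h : ∀ k, M.m k ≤ N.m k) : M.germRing ≤ N.germRing := by
  rintro _ ⟨U, hU, h0, f, ⟨hf, A, B, hA, hB, hb⟩, rfl⟩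
  refine ⟨U, hU, h0, f, ⟨hf, A, B, hA, hB, fun k x hx => (hb k x hx).trans ?_⟩, rfl⟩
  gcongr
  exact h k

/-- A function in `K` and, to the right of the origin, in `M`, all of whose neighbourhoods of the
origin contain points at which its derivatives violate the `N`-bounds. -/
theorem exists_singular_chain {M N K : DCWeight}
    (hM : Tendsto (fun j => M.m (j + 1) / M.m j) atTop atTop)
    (hK : Tendsto (fun j => K.m (j + 1) / K.m j) atTop atTop)
    (hNK : ∀ D : ℝ, 1 ≤ D → ∃ C : ℝ, 0 < C ∧ ∀ k, D ^ k * N.m k ≤ C * K.m k) :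
    ∃ F : ℕ → ℝ → ℂ, IsDerivChain F univ ∧
      (∀ k x, ‖F k x‖ ≤ (k ! : ℝ) * (2 * 1 ^ k * K.m k)) ∧
      (∀ k, ∀ x, 0 ≤ x → ‖F k x‖ ≤ (k ! : ℝ) * (2 * 1 ^ k * M.m k)) ∧
      ∀ j : ℕ, ∃ k,
        (k ! : ℝ) * (((j : ℝ) + 1) ^ (k + 1) * N.m k) ≤ ‖F k (-(1 / ((j : ℝ) + 1)))‖ := by
  set X : ℕ → ℝ := fun j => ((j : ℝ) + 1) * (j + 2)
  have hX : ∀ j, 1 ≤ X j := fun j => by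
    have : (0 : ℝ) ≤ j := j.cast_nonneg
    simp only [X]
    nlinarith
  have hX0 : ∀ j, 0 < X j := fun j => one_pos.trans_le (hX j)
  -- The factor `2 ^ j` undoes the dyadic weight, `2 * X j` outweighs the other poles, and `j + 1`
  -- is the excess over the `N`-bounds that remains.
  set D : ℕ → ℝ := fun j => 2 ^ j * (2 * X j + (j + 1))
  have hD : ∀ j, 1 ≤ D j := fun j => by
    have h1 : (1 : ℝ) ≤ 2 ^ j := one_le_pow₀ (by norm_num)
    have h2 : (0 : ℝ) ≤ j := j.cast_nonneg
    exact one_le_mul_of_one_le_of_one_le h1 (by linarith [hX j])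
  have hδ : ∀ j : ℕ, 0 < 1 / ((j : ℝ) + 1) := fun j => by positivity
  have hδ1 : ∀ j : ℕ, 1 / ((j : ℝ) + 1) ≤ 1 := fun j => by
    rw [div_le_one (by positivity)]
    linarith [(j.cast_nonneg : (0 : ℝ) ≤ j)]
  choose ε c hε hc hc1 hcK hcM k hk using fun j => exists_pole hM hK hNK (hδ j) (hδ1 j) (hD j)
  refine ⟨_, isDerivChain_poleSum (δ := fun j : ℕ => 1 / ((j : ℝ) + 1)) hc hε hcK,
    norm_poleSum_le hc hε hcK, fun k x hx => norm_poleSum_le_of_nonneg hc hδ hcM k hx,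
    fun j => ⟨k j, ?_⟩⟩
  refine le_trans ?_ (le_norm_poleSum (δ := fun j : ℕ => 1 / ((j : ℝ) + 1)) hc hc1 hε hcK j (k j)
    (hX0 j) fun i hi => inv_le_abs_inv_sub_inv i j hi)
  have hN1 := N.one_le (k j)
  have hXj := hX0 j
  refine mul_le_mul_of_nonneg_left ?_ (by positivity)
  have h1 : (2 * X j) ^ (k j + 1) + ((j : ℝ) + 1) ^ (k j + 1) ≤
      (2 * X j + (j + 1)) ^ (k j + 1) :=
    pow_succ_add_pow_succ_le (by positivity) (by positivity) _
  have h2 : 2 * X j ^ (k j + 1) ≤ (2 * X j) ^ (k j + 1) := by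
    have h0 : (2 : ℝ) ≤ 2 ^ (k j + 1) := le_self_pow₀ (by norm_num) (by omega)
    rw [mul_pow 2 (X j)]
    exact mul_le_mul_of_nonneg_right h0 (by positivity)
  have h3 : (2 : ℝ) ^ j ≤ (2 ^ j) ^ (k j + 1) :=
    le_self_pow₀ (one_le_pow₀ (by norm_num)) (by omega)
  have h4 : (2 * X j + ((j : ℝ) + 1)) ^ (k j + 1) * N.m (k j) ≤
      (1 / 2) ^ j * (c j / ε j ^ (k j + 1)) := by
    calc (2 * X j + ((j : ℝ) + 1)) ^ (k j + 1) * N.m (k j)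
        = (1 / 2) ^ j * (2 ^ j * ((2 * X j + ((j : ℝ) + 1)) ^ (k j + 1) * N.m (k j))) := by
          rw [← mul_assoc ((1 / 2 : ℝ) ^ j), ← mul_pow]
          norm_num
      _ ≤ (1 / 2) ^ j * ((2 ^ j) ^ (k j + 1) *
            ((2 * X j + ((j : ℝ) + 1)) ^ (k j + 1) * N.m (k j))) := by gcongr
      _ = (1 / 2) ^ j * (D j ^ (k j + 1) * N.m (k j)) := by
          simp only [D]
          rw [mul_pow, mul_assoc]
      _ ≤ _ := by gcongr; exact hk j
  have h5 : 2 * X j ^ (k j + 1) ≤ 2 * X j ^ (k j + 1) * N.m (k j) :=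
    le_mul_of_one_le_right (by positivity) hN1
  have h6 : (2 * X j ^ (k j + 1) + ((j : ℝ) + 1) ^ (k j + 1)) * N.m (k j) ≤
      (2 * X j + (j + 1)) ^ (k j + 1) * N.m (k j) := by
    gcongr
    linarith
  linarith

/-- A chain which violates the `N`-bounds near the origin does not represent a germ in `N`. -/
theorem not_mem_germRing {N : DCWeight} {F : ℕ → ℝ → ℂ} (hF : IsDerivChain F univ)
    (h : ∀ j : ℕ, ∃ k,
      (k ! : ℝ) * (((j : ℝ) + 1) ^ (k + 1) * N.m k) ≤ ‖F k (-(1 / ((j : ℝ) + 1)))‖) :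
    ((F 0 : ℝ → ℂ) : Germ (𝓝 (0 : ℝ)) ℂ) ∉ N.germRing := by
  intro hmem
  obtain ⟨G, r, A, B, hr, hA, hB, hG, hGb, hGF⟩ := N.exists_isDerivChain hmem
  obtain ⟨ρ, hρ, hρF⟩ := Metric.eventually_nhds_iff_ball.1 (Germ.coe_eq.1 hGF)
  rw [Real.ball_eq_Ioo, zero_sub, zero_add] at hρF
  set u := Ioo (-min r ρ) (min r ρ)
  have hur : u ⊆ Ioo (-r) r :=
    Ioo_subset_Ioo (neg_le_neg (min_le_left _ _)) (min_le_left _ _)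
  have huρ : u ⊆ Ioo (-ρ) ρ :=
    Ioo_subset_Ioo (neg_le_neg (min_le_right _ _)) (min_le_right _ _)
  have heq := fun k => (hG.mono hur).eqOn (hF.mono (subset_univ u)) isOpen_Ioo.uniqueDiffOn
    (fun x hx => hρF x (huρ hx)) k
  -- One `j` serves both purposes: `-1 / (j + 1)` is in the common interval, and `j + 1` exceeds
  -- both constants of the supposed `N`-bounds.
  obtain ⟨j, hj1, hj2⟩ := ((tendsto_one_div_add_atTop_nhds_zero_nat.eventually_lt_const
    (lt_min hr hρ)).and (tendsto_natCast_atTop_atTop.eventually_ge_atTop (max A B))).exists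
  obtain ⟨k, hk⟩ := h j
  have hjpos : 0 < 1 / ((j : ℝ) + 1) := by positivity
  have hx : -(1 / ((j : ℝ) + 1)) ∈ u := ⟨by linarith, by linarith⟩
  have hb := hGb k _ (hur hx)
  rw [heq k hx] at hb
  have hA' : A < j + 1 := by linarith [le_max_left A B]
  have hB' : B ≤ j + 1 := by linarith [le_max_right A B]
  have hN := N.pos k
  have : A * B ^ k * N.m k < ((j : ℝ) + 1) ^ (k + 1) * N.m k := by
    have hBk : B ^ k ≤ ((j : ℝ) + 1) ^ k := by gcongr
    rw [pow_succ']
    refine mul_lt_mul_of_pos_right ?_ hN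
    exact mul_lt_mul hA' hBk (by positivity) (by positivity)
  have hfac : (0 : ℝ) < k ! := by exact_mod_cast k.factorial_pos
  have := mul_lt_mul_of_pos_left this hfac
  linarith

end DCWeight

/-! ### Conclusion -/

theorem mainTheorem3 (M N : DCWeight)
    (hM : M.QuasiAnalytic) (hMO : analyticGermRing < M.germRing) (hN : N.QuasiAnalytic) :
    ∃ K : DCWeight, K.QuasiAnalytic ∧ analyticGermRing < K.germRing ∧
      N.germRing ≤ K.germRing ∧
      ((M.plusGerms ∩ restrictPlus '' (K.germRing : Set (Germ (𝓝 (0 : ℝ)) ℂ))) \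
        restrictPlus '' (N.germRing : Set (Germ (𝓝 (0 : ℝ)) ℂ))).Nonempty := by
  obtain ⟨R, hR, h1, h2, htop, hK⟩ := hN.exists_mulRatio
  set K := N.mulRatio R hR h1 h2
  have hKm : ∀ k, K.m k = N.m k * ∏ i ∈ Finset.range k, R i := fun k => rfl
  have hp : ∀ k, 0 < ∏ i ∈ Finset.range k, R i := fun k =>
    Finset.prod_pos fun i _ => one_pos.trans_le (h1 i)
  have hNK : ∀ D : ℝ, 1 ≤ D → ∃ C : ℝ, 0 < C ∧ ∀ k, D ^ k * N.m k ≤ C * K.m k := by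
    intro D hD
    obtain ⟨C, hC, hCR⟩ := exists_pow_le_mul_prod h1 htop hD
    refine ⟨C, hC, fun k => ?_⟩
    have := N.pos k
    calc D ^ k * N.m k ≤ (C * ∏ i ∈ Finset.range k, R i) * N.m k := by
          gcongr
          exact hCR k
      _ = _ := by rw [hKm]; ring
  have hKtop : Tendsto (fun j => K.m (j + 1) / K.m j) atTop atTop := by
    refine tendsto_atTop_mono (fun j => ?_) htop
    have e : K.m (j + 1) / K.m j = N.m (j + 1) / N.m j * R j := by
      rw [hKm, hKm, Finset.prod_range_succ]
      have := (hp j).ne'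
      have := (N.pos j).ne'
      field_simp
    rw [e]
    exact le_mul_of_one_le_left (zero_le_one.trans (h1 j)) (N.one_le_ratio j)
  have hNleK : N.germRing ≤ K.germRing := DCWeight.germRing_mono fun k => by
    rw [hKm]
    exact le_mul_of_one_le_right (N.pos k).le (one_le_prod_range h1 k)
  obtain ⟨F, hF, hFK, hFM, hFN⟩ := DCWeight.exists_singular_chain (M.tendsto_ratio hMO) hKtop hNK
  have hFN' := DCWeight.not_mem_germRing hF hFN
  have hFK' : ((F 0 : ℝ → ℂ) : Germ (𝓝 (0 : ℝ)) ℂ) ∈ K.germRing :=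
    K.mem_germRing hF isOpen_univ (mem_univ _) two_pos one_pos fun k x _ => hFK k x
  refine ⟨K, hK, lt_of_le_not_ge K.analyticGermRing_le fun hle => ?_, hNleK,
    restrictPlus (F 0 : ℝ → ℂ), ⟨?_, _, hFK', rfl⟩, ?_⟩
  -- If all germs of `K` were analytic, the singular germ would lie in the class of `N`.
  · exact hFN' (N.analyticGermRing_le (hle hFK'))
  · exact ⟨1, one_pos, F 0, M.mem_functionClass (hF.mono (subset_univ _)) (uniqueDiffOn_Ico 0 1)
      two_pos one_pos fun k x hx => hFM k x hx.1, rfl⟩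
  · rintro ⟨a, ha, haF⟩
    obtain ⟨G, r, A, B, hr, hA, hB, hG, hGb, rfl⟩ := N.exists_isDerivChain ha
    have h : G 0 =ᶠ[𝓝[≥] (0 : ℝ)] F 0 := Germ.coe_eq.1 haF
    -- Only the right halves are known to agree; quasi-analyticity of the larger class `K`, which
    -- contains both germs, extends the equality to the left, where the singularities are.
    have := hK.eventuallyEq_of_restrictPlus hr hG (hF.mono (subset_univ _)) (hNleK ha) hFK' h
    rw [← Germ.coe_eq.2 this] at hFN'
    exact hFN' ha
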